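/- A ($c_1$-)digital image is a subset $X\subseteq\mathbb Z^n$ for some $n$, two points being adjacent if they differ by $1$ in exactly one coordinate and agree in all others; a function between digital images is continuous if it maps adjacent points to equal or adjacent points. A pair $(X,A)$ consists of digital images $A\subseteq X\subseteq\mathbb Z^n$; a map of pairs $(X,A)\to(Y,B)$ is a continuous $f:X\to Y$ with $f(A)\subseteq B$. Maps of pairs $f,g$ are homotopic if there are $k>0$ and maps of pairs $H_0=f,H_1,\dots,H_k=g$ such that $H_t(x)$ and $H_{t+1}(x)$ are equal or adjacent for all $x$ and $0\le t<k$. For $A\subseteq X$ put $\mathrm{Int}(A)=\{x\in A: \text{every neighbour of } x \text{ in } X \text{ lies in } A\}$, $\mathrm{Int}^0(A)=A$, and $\mathrm{Int}^{i}(A)=\mathrm{Int}(\mathrm{Int}^{i-1}(A))$ for $i\ge1$, all taken in $X$. A digital homology theory consists of functors $H_q$ ($q\ge 0$) from pairs of $c_1$-digital images to abelian groups and homomorphisms $\delta:H_{q+1}(X,A)\to H_q(A)$, natural in $(X,A)$, where $H_q(A)=H_q(A,\emptyset)$, such that: 1. (Homotopy) homotopic maps of pairs induce the same homomorphisms; 2.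 (Exactness) for every pair the sequence $\cdots\to H_{q+1}(X,A)\xrightarrow{\delta}H_q(A)\to H_q(X)\to H_q(X,A)\to\cdots\to H_0(X)\to H_0(X,A)\to 0$ is exact, the unnamed maps between groups of equal degree being induced by inclusions; 3. (Excision) if $A,B\subseteq X$ and $X=\mathrm{Int}^i(A)\cup\mathrm{Int}^i(B)$ for a positive integer $i$, then the inclusion induces isomorphisms $H_q(B,A\cap B)\cong H_q(X,A)$ for all $q<i+1$; 4. (Dimension) $H_q$ of a one-point image is $0$ for $q>0$; 5. (Additivity) if $X$ is a union of pairwise disjoint subsets $U_\alpha$ such that no point of one is adjacent to a point of another, and $A\subseteq X$, then the inclusions induce an isomorphism $\bigoplus_\alpha H_q(U_\alpha,A\cap U_\alpha)\cong H_q(X,A)$ for all $q$. An elementary $q$-cube in $X\subseteq\mathbb Z^n$ is a product $Q=J_1\times\cdots\times J_n\subseteq X$ in which exactly $q$ factors $J_{j_1},\dots,J_{j_q}$ ($j_1<\dots<j_q$) have the form $\{a,a+1\}$ and the others are single points. Let $C_q^{c_1}(X)$ be the free abelian group on these cubes, with boundary operator $\partial Q=\sum_{i=1}^q(-1)^i(A_{j_i}Q-B_{j_i}Q)$,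 where $A_jQ$ and $B_jQ$ are obtained from $Q$ by replacing $J_j$ by $\{\min J_j\}$ and $\{\max J_j\}$ respectively. The $c_1$-cubical homology $H_q^{c_1}(X,A)$ is the homology of the quotient complex $C_*^{c_1}(X)/C_*^{c_1}(A)$. A continuous $f:X\to Y$ induces $f_q:C_q^{c_1}(X)\to C_q^{c_1}(Y)$ by $f_q(Q)=0$ if $f$ is not injective on $Q$, and $f_q(Q)=o\cdot f(Q)$ otherwise, where $f(Q)$ is an elementary $q$-cube and $o=\pm1$ is the determinant of the linear part of the affine map $f|_Q:Q\to f(Q)$, expressed in the nondegenerate coordinates of $Q$ and $f(Q)$ in increasing order. **Theorem.** The groups $H_q^{c_1}(X,A)$, with the homomorphisms induced by the $f_q$ and with the connecting homomorphisms that send the class of $c\in C_{q+1}^{c_1}(X)$ with $\partial c\in C_q^{c_1}(A)$ to the class of $\partial c$ (both kinds of homomorphisms being well defined), form a digital homology theory. Moreover $H_0^{c_1}$ of a one-point image is isomorphic to $\mathbb Z$. -/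

import Mathlib

open CategoryTheory

noncomputable section

namespace DigitalHomology

/-! ### Digital images with `c₁`-adjacency -/

/-- `c₁`-adjacency of points of `ℤⁿ`: the points differ by `1` in exactly one coordinate and agree
in all the others. -/
def Adj {n : ℕ} (x y : Fin n → ℤ) : Prop :=
  ∃ i, |x i - y i| = 1 ∧ ∀ j, j ≠ i → x j = y j

/-- Two points are equal or `c₁`-adjacent. -/
def AdjEq {n : ℕ} (x y : Fin n → ℤ) : Prop :=
  x = y ∨ Adj x y

/-- A function between digital images is continuous if adjacent points are mapped to equal or
adjacent points. -/
def IsContinuous {n m : ℕ} {X : Set (Fin n → ℤ)} {Y : Set (Fin m → ℤ)} (f : X → Y) : Prop :=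
  ∀ x x' : X, Adj (x : Fin n → ℤ) x' → AdjEq (f x : Fin m → ℤ) (f x')

/-- A pair `(X, A)` of `c₁`-digital images: `A ⊆ X ⊆ ℤⁿ`. -/
structure DigitalPair where
  n : ℕ
  X : Set (Fin n → ℤ)
  A : Set (Fin n → ℤ)
  sub : A ⊆ X

namespace DigitalPair

/-- A map of pairs `(X, A) → (Y, B)`: a continuous function `X → Y` that maps `A` into `B`. -/
@[ext]
structure Hom (P Q : DigitalPair) where
  toFun : P.X → Q.X
  continuous : IsContinuous toFun
  mapsTo : ∀ x : P.X, (x : Fin P.n → ℤ) ∈ P.A → (toFun x : Fin Q.n → ℤ) ∈ Q.A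

/-- The category of pairs of `c₁`-digital images. -/
instance : Category DigitalPair where
  Hom := Hom
  id P := ⟨fun x => x, fun _ _ h => Or.inr h, fun _ h => h⟩
  comp {_ _ R} f g := ⟨fun x => g.toFun (f.toFun x), fun x x' h => by
      rcases f.continuous x x' h with h | h
      · exact Or.inl (congrArg (fun y => (g.toFun y : Fin R.n → ℤ)) (Subtype.ext h))
      · exact g.continuous _ _ h,
    fun x h => g.mapsTo _ (f.mapsTo x h)⟩

/-- A digital image `X` regarded as the pair `(X, ∅)`. -/
def single {n : ℕ} (X : Set (Fin n → ℤ)) : DigitalPair := ⟨n, X, ∅, Set.empty_subset X⟩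

/-- The inclusion `(X', A') → (X, A)` of pairs in the same `ℤⁿ`. -/
def incl {n : ℕ} {X' A' X A : Set (Fin n → ℤ)} (h' : A' ⊆ X') (h : A ⊆ X)
    (hX : X' ⊆ X) (hA : A' ⊆ A) :
    (⟨n, X', A', h'⟩ : DigitalPair) ⟶ ⟨n, X, A, h⟩ where
  toFun x := ⟨x.1, hX x.2⟩
  continuous _ _ hx := Or.inr hx
  mapsTo _ hx := hA hx

/-- The inclusion `A = (A, ∅) → (X, ∅) = X`. -/
def inclSub (P : DigitalPair) : single P.A ⟶ single P.X :=
  incl (Set.empty_subset _) (Set.empty_subset _) P.sub (Set.empty_subset _)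

/-- The inclusion `X = (X, ∅) → (X, A)`. -/
def inclRel (P : DigitalPair) : single P.X ⟶ P :=
  incl (Set.empty_subset _) P.sub subset_rfl (Set.empty_subset _)

/-- The restriction `A → B` of a map of pairs `(X, A) → (Y, B)`. -/
def restrict {P Q : DigitalPair} (f : P ⟶ Q) : single P.A ⟶ single Q.A where
  toFun (x : P.A) := (⟨Hom.toFun f ⟨x.1, P.sub x.2⟩, Hom.mapsTo f _ x.2⟩ : Q.A)
  continuous (x x' : P.A) h := Hom.continuous f ⟨x.1, P.sub x.2⟩ ⟨x'.1, P.sub x'.2⟩ h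
  mapsTo _ h := h.elim

/-- Maps of pairs `f` and `g` are homotopic: there are maps of pairs `H₀ = f, H₁, …, Hₖ = g`, with
`k > 0`, such that `t ↦ Hₜ(x)` is continuous on the digital interval `[0, k]` for each `x`. -/
def Homotopic {P Q : DigitalPair} (f g : P ⟶ Q) : Prop :=
  ∃ (k : ℕ) (H : Fin (k + 1) → (P ⟶ Q)), 0 < k ∧ H 0 = f ∧ H (Fin.last k) = g ∧
    ∀ (x : P.X) (s t : Fin (k + 1)), (t : ℕ) = s + 1 →
      AdjEq (Hom.toFun (H s) x : Fin Q.n → ℤ) (Hom.toFun (H t) x)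

end DigitalPair

/-- The interior of `A` in the digital image `X`: the points of `A` all of whose neighbours in `X`
lie in `A`. -/
def interior {n : ℕ} (X A : Set (Fin n → ℤ)) : Set (Fin n → ℤ) :=
  {x | x ∈ A ∧ ∀ y ∈ X, AdjEq x y → y ∈ A}

/-- The iterated interior `Intⁱ(A)` in `X`. -/
def iterInterior {n : ℕ} (X : Set (Fin n → ℤ)) : ℕ → Set (Fin n → ℤ) → Set (Fin n → ℤ)
  | 0, A => A
  | i + 1, A => interior X (iterInterior X i A)

/-! ### Digital homology theories -/

open DigitalPair in
open scoped Classical in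
/-- The structure of a digital homology theory on groups `H q (X, A)`, `q ≥ 0`, on the category of
pairs of `c₁`-digital images: induced homomorphisms that make each `H q` a functor, natural
connecting homomorphisms, and the homotopy, exactness, excision, dimension and additivity
axioms. -/
structure DigitalHomologyTheory (H : ℕ → DigitalPair → Type)
    [∀ q P, AddCommGroup (H q P)] where
  map : ∀ (q : ℕ) {P Q : DigitalPair}, (P ⟶ Q) → (H q P →+ H q Q)
  map_id : ∀ (q : ℕ) (P : DigitalPair), map q (𝟙 P) = AddMonoidHom.id (H q P)
  map_comp : ∀ (q : ℕ) {P Q R : DigitalPair} (f : P ⟶ Q) (g : Q ⟶ R),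
    map q (f ≫ g) = (map q g).comp (map q f)
  /-- The connecting homomorphism `H_{q+1}(X, A) → H_q(A)`. -/
  δ : ∀ (q : ℕ) (P : DigitalPair), H (q + 1) P →+ H q (single P.A)
  δ_natural : ∀ (q : ℕ) {P Q : DigitalPair} (f : P ⟶ Q),
    (δ q Q).comp (map (q + 1) f) = (map q (restrict f)).comp (δ q P)
  homotopy : ∀ (q : ℕ) {P Q : DigitalPair} (f g : P ⟶ Q), Homotopic f g → map q f = map q g
  exact_X : ∀ (q : ℕ) (P : DigitalPair), Function.Exact (map q (inclSub P)) (map q (inclRel P))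
  exact_rel : ∀ (q : ℕ) (P : DigitalPair), Function.Exact (map (q + 1) (inclRel P)) (δ q P)
  exact_A : ∀ (q : ℕ) (P : DigitalPair), Function.Exact (δ q P) (map q (inclSub P))
  exact_zero : ∀ P : DigitalPair, Function.Surjective (map 0 (inclRel P))
  /-- If `X = Intⁱ(A) ∪ Intⁱ(B)` with `i > 0`, then `(B, A ∩ B) → (X, A)` induces isomorphisms in
  the degrees `q < i + 1`. -/
  excision : ∀ {n : ℕ} (X A B : Set (Fin n → ℤ)) (hA : A ⊆ X) (hB : B ⊆ X) (i q : ℕ), 0 < i →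
    X = iterInterior X i A ∪ iterInterior X i B → q < i + 1 →
    Function.Bijective (map q
      (incl (Set.inter_subset_right : A ∩ B ⊆ B) hA hB Set.inter_subset_left))
  dimension : ∀ {n : ℕ} (x : Fin n → ℤ) (q : ℕ), 0 < q → Subsingleton (H q (single {x}))
  /-- If `X` is the union of pairwise disjoint subsets `U α`, such that no point of one is adjacent
  to a point of another, then the inclusions `(U α, A ∩ U α) → (X, A)` induce an isomorphism from
  the direct sum of the groups `H_q(U α, A ∩ U α)` to `H_q(X, A)`. -/
  additivity : ∀ {n : ℕ} (X A : Set (Fin n → ℤ)) (hA : A ⊆ X) (ι : Type)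
    (U : ι → Set (Fin n → ℤ)) (hU : ∀ α, U α ⊆ X), X = ⋃ α, U α →
    (∀ α β, α ≠ β → ∀ x ∈ U α, ∀ y ∈ U β, ¬ AdjEq x y) → ∀ q : ℕ,
    Function.Bijective (DirectSum.toAddMonoid fun α => map q
      (incl (Set.inter_subset_right : A ∩ U α ⊆ U α) hA (hU α) Set.inter_subset_left))

/-! ### The `c₁`-cubical chain complex -/

/-- An elementary `q`-cube `J₁ × ⋯ × Jₙ` contained in `X ⊆ ℤⁿ`. It is given by the point
`corner = (min J₁, …, min Jₙ)` and by the increasing enumeration `dir` of the `q` indices of the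
nondegenerate intervals `Jⱼ`; its points are the elements of the product. -/
@[ext]
structure Cube (q : ℕ) {n : ℕ} (X : Set (Fin n → ℤ)) where
  corner : Fin n → ℤ
  dir : Fin q ↪o Fin n
  subset : {v : Fin n → ℤ | ∀ j, v j = corner j ∨ (j ∈ Set.range dir ∧ v j = corner j + 1)} ⊆ X

namespace Cube

variable {q n : ℕ} {X : Set (Fin n → ℤ)}

/-- The underlying set of an elementary cube. -/
def points (Q : Cube q X) : Set (Fin n → ℤ) :=
  {v | ∀ j, v j = Q.corner j ∨ (j ∈ Set.range Q.dir ∧ v j = Q.corner j + 1)}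

theorem corner_mem (Q : Cube q X) : Q.corner ∈ Q.points := fun _ => Or.inl rfl

/-- The vertex next to the corner in the `i`-th nondegenerate direction. -/
def edge (Q : Cube q X) (i : Fin q) : Fin n → ℤ :=
  Function.update Q.corner (Q.dir i) (Q.corner (Q.dir i) + 1)

theorem edge_mem (Q : Cube q X) (i : Fin q) : Q.edge i ∈ Q.points := by
  intro j
  by_cases h : j = Q.dir i
  · subst h
    exact Or.inr ⟨⟨i, rfl⟩, by simp [edge]⟩
  · exact Or.inl (by simp [edge, h])

/-- The face of an elementary cube in which its `i`-th nondegenerate interval is replaced by its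
minimum. -/
def frontFace (Q : Cube (q + 1) X) (i : Fin (q + 1)) : Cube q X where
  corner := Q.corner
  dir := (Fin.succAboveOrderEmb i).trans Q.dir
  subset v hv := Q.subset fun j => by
    rcases hv j with h | ⟨⟨k, hk⟩, h⟩
    · exact Or.inl h
    · exact Or.inr ⟨⟨i.succAbove k, hk⟩, h⟩

/-- The face of an elementary cube in which its `i`-th nondegenerate interval is replaced by its
maximum. -/
def backFace (Q : Cube (q + 1) X) (i : Fin (q + 1)) : Cube q X where
  corner := Q.edge i
  dir := (Fin.succAboveOrderEmb i).trans Q.dir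
  subset v hv := Q.subset fun j => by
    by_cases hj : j = Q.dir i
    · subst hj
      rcases hv (Q.dir i) with h | ⟨⟨k, hk⟩, h⟩
      · exact Or.inr ⟨⟨i, rfl⟩, by simpa [edge] using h⟩
      · exact absurd (Q.dir.injective hk) (Fin.succAbove_ne i k)
    · rcases hv j with h | ⟨⟨k, hk⟩, h⟩
      · exact Or.inl (by simpa [edge, hj] using h)
      · exact Or.inr ⟨⟨i.succAbove k, hk⟩, by simpa [edge, hj] using h⟩

theorem frontFace_points (Q : Cube (q + 1) X) (i : Fin (q + 1)) :
    (Q.frontFace i).points ⊆ Q.points := by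
  let Q' : Cube (q + 1) Q.points := ⟨Q.corner, Q.dir, subset_rfl⟩
  exact (Q'.frontFace i).subset

theorem backFace_points (Q : Cube (q + 1) X) (i : Fin (q + 1)) :
    (Q.backFace i).points ⊆ Q.points := by
  let Q' : Cube (q + 1) Q.points := ⟨Q.corner, Q.dir, subset_rfl⟩
  exact (Q'.backFace i).subset

end Cube

/-- The group `C_q(X)`, free abelian on the elementary `q`-cubes in `X`. -/
abbrev Chain (q : ℕ) {n : ℕ} (X : Set (Fin n → ℤ)) : Type := Cube q X →₀ ℤ

/-- The boundary operator `∂Q = ∑ᵢ (-1)ⁱ (Aᵢ Q - Bᵢ Q)`, where `i` runs from `1` to `q + 1`. -/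
def boundary (q : ℕ) {n : ℕ} (X : Set (Fin n → ℤ)) : Chain (q + 1) X →ₗ[ℤ] Chain q X :=
  Finsupp.linearCombination ℤ fun Q => ∑ i : Fin (q + 1), (-1 : ℤ) ^ ((i : ℕ) + 1) •
    (Finsupp.single (Q.frontFace i) 1 - Finsupp.single (Q.backFace i) 1)

theorem boundary_comp_boundary (q : ℕ) {n : ℕ} (X : Set (Fin n → ℤ)) :
    boundary q X ∘ₗ boundary (q + 1) X = 0 := by
  refine Finsupp.lhom_ext' fun Q => LinearMap.ext_ring ?_
  have key : ∀ (i : Fin (q + 2)) (j : Fin (q + 1)),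
      (Q.frontFace (i.succAbove j)).frontFace (j.predAbove i) = (Q.frontFace i).frontFace j ∧
      (Q.frontFace (i.succAbove j)).backFace (j.predAbove i) = (Q.backFace i).frontFace j ∧
      (Q.backFace (i.succAbove j)).frontFace (j.predAbove i) = (Q.frontFace i).backFace j ∧
      (Q.backFace (i.succAbove j)).backFace (j.predAbove i) = (Q.backFace i).backFace j := by
    intro i j
    have hd : ∀ k, Q.dir ((i.succAbove j).succAbove ((j.predAbove i).succAbove k)) =
        Q.dir (i.succAbove (j.succAbove k)) := fun k => by
      rw [Fin.succAbove_succAbove_succAbove_predAbove]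
    have hne : Q.dir (i.succAbove j) ≠ Q.dir i :=
      fun h => Fin.succAbove_ne i j (Q.dir.injective h)
    refine ⟨?_, ?_, ?_, ?_⟩ <;> refine Cube.ext ?_ (RelEmbedding.ext hd)
    · rfl
    · simp [Cube.frontFace, Cube.backFace, Cube.edge, Fin.succAbove_succAbove_predAbove]
    · simp [Cube.frontFace, Cube.backFace, Cube.edge]
    · simp [Cube.backFace, Cube.edge, Fin.succAbove_succAbove_predAbove, hne, hne.symm,
        Function.update_comm hne]
  simp only [LinearMap.comp_apply, Finsupp.lsingle_apply, LinearMap.zero_apply, boundary,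
    Finsupp.linearCombination_single, one_smul, map_sum, map_smul, map_sub, ← Finset.sum_sub_distrib,
    Finset.smul_sum, ← smul_sub]
  rw [← Finset.sum_product']
  refine Finset.sum_involution (fun p _ => (p.1.succAbove p.2, p.2.predAbove p.1)) ?_ ?_ ?_ ?_
  · rintro ⟨i, j⟩ -
    obtain ⟨h1, h2, h3, h4⟩ := key i j
    have hs : (-1 : ℤ) ^ ((i.succAbove j : ℕ) + (j.predAbove i : ℕ)) =
        -(-1) ^ ((i : ℕ) + (j : ℕ)) := Fin.neg_one_pow_succAbove_add_predAbove i j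
    simp only [h1, h2, h3, h4, smul_smul, ← pow_add]
    have e1 : ∀ a b : ℕ, (-1 : ℤ) ^ (a + 1 + (b + 1)) = (-1) ^ (a + b) := fun a b => by ring
    rw [e1, e1, hs]
    module
  · rintro ⟨i, j⟩ - - h
    exact Fin.succAbove_ne i j (congrArg Prod.fst h)
  · simp
  · rintro ⟨i, j⟩ -
    simp [Fin.succAbove_succAbove_predAbove, Fin.predAbove_predAbove_succAbove]

/-- The subgroup of `C_q(X)` spanned by the elementary cubes in `A`. -/
def chainsIn (q : ℕ) {n : ℕ} (X A : Set (Fin n → ℤ)) : Submodule ℤ (Chain q X) :=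
  Submodule.span ℤ {c | ∃ Q : Cube q X, Q.points ⊆ A ∧ c = Finsupp.single Q 1}

theorem single_mem_chainsIn {q n : ℕ} {X A : Set (Fin n → ℤ)} (Q : Cube q X) (h : Q.points ⊆ A) :
    Finsupp.single Q (1 : ℤ) ∈ chainsIn q X A :=
  Submodule.subset_span ⟨Q, h, rfl⟩

theorem chainsIn_le_comap_boundary (q : ℕ) {n : ℕ} (X A : Set (Fin n → ℤ)) :
    chainsIn (q + 1) X A ≤ (chainsIn q X A).comap (boundary q X) := by
  refine Submodule.span_le.2 ?_
  rintro _ ⟨Q, hQ, rfl⟩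
  simp only [SetLike.mem_coe, Submodule.mem_comap, boundary, Finsupp.linearCombination_single,
    one_smul]
  exact Submodule.sum_mem _ fun i _ => Submodule.smul_mem _ _ (Submodule.sub_mem _
    (single_mem_chainsIn _ ((Q.frontFace_points i).trans hQ))
    (single_mem_chainsIn _ ((Q.backFace_points i).trans hQ)))

/-- The relative chain group `C_q(X, A) = C_q(X) / C_q(A)`. -/
abbrev RelChain (q : ℕ) (P : DigitalPair) : Type := Chain q P.X ⧸ chainsIn q P.X P.A

/-- The boundary operator of the relative chain complex. -/
def relBoundary (q : ℕ) (P : DigitalPair) : RelChain (q + 1) P →ₗ[ℤ] RelChain q P :=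
  Submodule.mapQ _ _ (boundary q P.X) (chainsIn_le_comap_boundary q P.X P.A)

/-- The relative `q`-cycles. -/
def relCycles : (q : ℕ) → (P : DigitalPair) → Submodule ℤ (RelChain q P)
  | 0, _ => ⊤
  | q + 1, P => LinearMap.ker (relBoundary q P)

/-- The `c₁`-cubical homology group `H_q(X, A)`, the `q`-cycles modulo the `q`-boundaries of the
relative chain complex. Since `C_q(∅) = 0`, the group `H_q(X)` is `H_q(X, ∅)`. -/
def C1Homology (q : ℕ) (P : DigitalPair) : Type :=
  relCycles q P ⧸ (LinearMap.range (relBoundary q P)).submoduleOf (relCycles q P)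

instance (q : ℕ) (P : DigitalPair) : AddCommGroup (C1Homology q P) :=
  inferInstanceAs (AddCommGroup
    (relCycles q P ⧸ (LinearMap.range (relBoundary q P)).submoduleOf (relCycles q P)))

/-- The homology class of a relative cycle. -/
def homologyClass {q : ℕ} {P : DigitalPair} (z : RelChain q P) (hz : z ∈ relCycles q P) :
    C1Homology q P :=
  ((LinearMap.range (relBoundary q P)).submoduleOf (relCycles q P)).mkQ ⟨z, hz⟩

/-! ### Induced homomorphisms of chain groups -/

section Induced

variable {q n m : ℕ} {X : Set (Fin n → ℤ)} {Y : Set (Fin m → ℤ)}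

/-- The image `f(Q)` of an elementary cube, as a set of points. -/
def imagePoints (f : X → Y) (Q : Cube q X) : Set (Fin m → ℤ) :=
  {y | ∃ x : X, (x : Fin n → ℤ) ∈ Q.points ∧ (f x : Fin m → ℤ) = y}

/-- The orientation of `f` on `Q`, where `R = f(Q)`: the determinant of the linear part of `f` on
`Q`, in the coordinates given by the nondegenerate directions of `Q` and `R`. -/
def orientation (f : X → Y) (Q : Cube q X) (R : Cube q Y) : ℤ :=
  Matrix.det (Matrix.of fun i k : Fin q =>
    (f ⟨Q.edge k, Q.subset (Q.edge_mem k)⟩ : Fin m → ℤ) (R.dir i) -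
      (f ⟨Q.corner, Q.subset Q.corner_mem⟩ : Fin m → ℤ) (R.dir i))

open scoped Classical in
/-- The value of the induced homomorphism on an elementary cube `Q`: it is `0` if `f` is not
injective on `Q`; otherwise `f(Q)` is an elementary `q`-cube `R` (for continuous `f`), and the value
is `R` with the sign given by the orientation. -/
def cubeMap (f : X → Y) (Q : Cube q X) : Chain q Y :=
  if h : Set.InjOn f {x | (x : Fin n → ℤ) ∈ Q.points} ∧ ∃ R : Cube q Y, R.points = imagePoints f Q
  then Finsupp.single h.2.choose (orientation f Q h.2.choose)
  else 0

/-- The induced homomorphism `C_q(X) → C_q(Y)`. -/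
def chainMap (q : ℕ) (f : X → Y) : Chain q X →ₗ[ℤ] Chain q Y :=
  Finsupp.linearCombination ℤ (cubeMap f)

end Induced

theorem chainsIn_le_comap_chainMap (q : ℕ) {P Q : DigitalPair} (f : P ⟶ Q) :
    chainsIn q P.X P.A ≤
      (chainsIn q Q.X Q.A).comap (chainMap q (DigitalPair.Hom.toFun f)) := by
  refine Submodule.span_le.2 ?_
  rintro _ ⟨S, hS, rfl⟩
  simp only [SetLike.mem_coe, Submodule.mem_comap, chainMap, Finsupp.linearCombination_single,
    one_smul, cubeMap]
  split_ifs with h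
  · rw [← mul_one (orientation _ _ _), ← smul_eq_mul, ← Finsupp.smul_single]
    refine Submodule.smul_mem _ _ (single_mem_chainsIn _ ?_)
    rw [h.2.choose_spec]
    rintro y ⟨x, hx, rfl⟩
    exact DigitalPair.Hom.mapsTo f x (hS hx)
  · exact Submodule.zero_mem _

/-- The induced homomorphism `C_q(X, A) → C_q(Y, B)` of a map of pairs. -/
def relChainMap (q : ℕ) {P Q : DigitalPair} (f : P ⟶ Q) : RelChain q P →ₗ[ℤ] RelChain q Q :=
  Submodule.mapQ _ _ (chainMap q (DigitalPair.Hom.toFun f)) (chainsIn_le_comap_chainMap q f)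

end DigitalHomology

end

open CategoryTheory

noncomputable section

namespace DigitalHomology

open DigitalPair

/-! ### Adjacency -/

/-! The one hard point is that the induced homomorphisms commute with the boundary operators. If `f`
is injective on a cube `Q`, then around each square of `Q` opposite edges have parallel images
(`exists_affine`). Hence `f` maps `Q` onto a cube by a signed permutation of coordinates
(`exists_isSignedPerm`). Commutation on `Q` is then the Laplace expansion of the determinant of that
permutation (`IsSignedPerm.boundary_chainMap`).

If `f` is not injective on a `(q + 1)`-cube `Q`, its induced chain is `0`, and the image of `∂Q` has
to vanish. By induction on the degree this image is a cycle (of augmentation `0` when `q = 0`), and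
its vertices lie in `f(Q)`, which has fewer than `2 ^ (q + 1)` points. But a nonzero reduced
`q`-cycle has at least `2 ^ (q + 1)` vertices (`IsReducedCycle.two_pow_le_card`). To see this in
positive degree, cut the cycle along the two walls that bound a cube of its support in one
direction. On each wall the cut produces a nonzero reduced cycle of one degree less, and the walls
are disjoint.

The axioms then follow on representing chains. Functoriality is multiplicativity of determinants,
and exactness uses that restriction of chains inverts the inclusion of `A`. For excision, a cube of
dimension at most `i + 1` lies in `A` or in `B` (`Cube.subset_or_subset`), so no subdivision is
needed. For additivity, each cube lies in one `U α`. For homotopy, the prism `{0, 1} × Q`, pushed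
forward along the map of the cylinder given by two consecutive stages, is a chain homotopy. -/

theorem adj_iff {n : ℕ} {x y : Fin n → ℤ} :
    Adj x y ↔ ∃ (i : Fin n) (e : ℤ), (e = 1 ∨ e = -1) ∧ y = x + Pi.single i e := by
  constructor
  · rintro ⟨i, hi, h⟩
    refine ⟨i, y i - x i, ?_, ?_⟩
    · rcases (abs_eq zero_le_one).1 hi with h | h <;> omega
    · funext j
      by_cases hj : j = i
      · subst hj; simp
      · simp [hj, h j hj]
  · rintro ⟨i, e, he, rfl⟩
    refine ⟨i, ?_, fun j hj => ?_⟩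
    · rcases he with rfl | rfl <;> simp
    · simp [hj]

theorem Adj.symm {n : ℕ} {x y : Fin n → ℤ} (h : Adj x y) : Adj y x := by
  obtain ⟨i, hi, h⟩ := h
  exact ⟨i, by rwa [abs_sub_comm], fun j hj => (h j hj).symm⟩

theorem AdjEq.symm {n : ℕ} {x y : Fin n → ℤ} (h : AdjEq x y) : AdjEq y x :=
  h.imp Eq.symm Adj.symm

/-- Two different two-step walks with the same end points, different from each other, are the two
sides of a square. -/
theorem single_add_single_eq {n : ℕ} {p p' r r' : Fin n} {a a' b b' : ℤ}
    (ha : a = 1 ∨ a = -1) (ha' : a' = 1 ∨ a' = -1) (hb : b = 1 ∨ b = -1) (hb' : b' = 1 ∨ b' = -1)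
    (h : (Pi.single p a + Pi.single p' a' : Fin n → ℤ) = Pi.single r b + Pi.single r' b')
    (h0 : (Pi.single p a + Pi.single p' a' : Fin n → ℤ) ≠ 0)
    (hne : (Pi.single p a : Fin n → ℤ) ≠ Pi.single r b) :
    p ≠ r ∧ p' = r ∧ a' = b := by
  have key : ∀ s t : Fin n, ∀ c d : ℤ, c = 1 ∨ c = -1 → d = 1 ∨ d = -1 →
      (Pi.single s c + Pi.single t d : Fin n → ℤ) ≠ 0 → ¬ (s = t ∧ d = -c) := by
    rintro s t c d - - h ⟨rfl, rfl⟩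
    exact h (by rw [← Pi.single_add]; simp)
  have h1 := key p p' a a' ha ha' h0
  have h2 := key r r' b b' hb hb' (h ▸ h0)
  have h3 : ¬ (p = r ∧ a = b) := by rintro ⟨rfl, rfl⟩; exact hne rfl
  -- Neither walk backtracks and the first steps differ, so the coordinates `p` and `r` alone force
  -- the second step of one walk to be the first step of the other.
  have ep := congrFun h p
  have er := congrFun h r
  simp only [Pi.add_apply, Pi.single_apply] at ep er
  grind

/-! ### Vertices of a cube -/

/-- Induction on Boolean vectors by changing entries from `false` to `true`. -/
theorem boolVec_induction {q : ℕ} {P : (Fin q → Bool) → Prop} (h0 : P fun _ => false)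
    (hs : ∀ t k, t k = false → P t → P (Function.update t k true)) (t : Fin q → Bool) : P t := by
  classical
  -- Boolean vectors are indicators of finite sets, and inserting an element switches one entry to
  -- `true`.
  have key : ∀ s : Finset (Fin q), P fun k => decide (k ∈ s) := by
    intro s
    induction s using Finset.induction_on with
    | empty => simpa using h0
    | insert k s hk ih =>
      convert hs _ k (by simpa using hk) ih using 1
      funext l
      by_cases hl : l = k
      · subst hl; simp
      · simp [hl]
  simpa using key (Finset.univ.filter fun k => t k = true)

namespace Cube

variable {q n : ℕ} {X : Set (Fin n → ℤ)}

/-- The vertex of an elementary cube with given Boolean coordinates. -/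
def vertex (Q : Cube q X) (t : Fin q → Bool) : Fin n → ℤ :=
  Q.corner + Function.extend Q.dir (fun k => (t k).toInt) 0

@[simp]
theorem vertex_dir (Q : Cube q X) (t : Fin q → Bool) (k : Fin q) :
    Q.vertex t (Q.dir k) = Q.corner (Q.dir k) + (t k).toInt := by
  simp [vertex, Q.dir.injective.extend_apply]

theorem vertex_of_notMem (Q : Cube q X) (t : Fin q → Bool) {j : Fin n}
    (h : j ∉ Set.range Q.dir) : Q.vertex t j = Q.corner j := by
  have h' : ¬ ∃ k, Q.dir k = j := h
  simp [vertex, Function.extend_apply' _ _ _ h']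

theorem vertex_injective (Q : Cube q X) : Function.Injective Q.vertex := by
  intro t t' h
  funext k
  have := congrFun h (Q.dir k)
  simp only [vertex_dir, add_right_inj] at this
  revert this
  cases t k <;> cases t' k <;> simp

theorem points_eq_range (Q : Cube q X) : Q.points = Set.range Q.vertex := by
  ext v
  constructor
  · intro h
    refine ⟨fun k => decide (v (Q.dir k) ≠ Q.corner (Q.dir k)), ?_⟩
    funext j
    by_cases hj : j ∈ Set.range Q.dir
    · obtain ⟨k, rfl⟩ := hj
      rw [vertex_dir]
      rcases h (Q.dir k) with h | ⟨-, h⟩ <;> simp [h]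
    · rw [vertex_of_notMem _ _ hj]
      rcases h j with h | ⟨h, -⟩
      · exact h.symm
      · exact absurd h hj
  · rintro ⟨t, rfl⟩ j
    by_cases hj : j ∈ Set.range Q.dir
    · obtain ⟨k, rfl⟩ := hj
      rw [vertex_dir]
      cases t k <;> simp
    · exact Or.inl (vertex_of_notMem _ _ hj)

theorem vertex_mem_points (Q : Cube q X) (t : Fin q → Bool) : Q.vertex t ∈ Q.points := by
  rw [points_eq_range]; exact ⟨t, rfl⟩

theorem vertex_mem (Q : Cube q X) (t : Fin q → Bool) : Q.vertex t ∈ X :=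
  Q.subset (Q.vertex_mem_points t)

theorem points_subset_iff (Q : Cube q X) {A : Set (Fin n → ℤ)} :
    Q.points ⊆ A ↔ ∀ t, Q.vertex t ∈ A := by
  rw [points_eq_range, Set.range_subset_iff]

theorem vertex_false (Q : Cube q X) : Q.vertex (fun _ => false) = Q.corner := by
  funext j
  by_cases hj : j ∈ Set.range Q.dir
  · obtain ⟨k, rfl⟩ := hj; simp
  · exact vertex_of_notMem _ _ hj

theorem vertex_update (Q : Cube q X) (t : Fin q → Bool) (k : Fin q) (b : Bool) :
    Q.vertex (Function.update t k b) =
      Q.vertex t + Pi.single (Q.dir k) (b.toInt - (t k).toInt) := by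
  funext j
  by_cases hj : j ∈ Set.range Q.dir
  · obtain ⟨l, rfl⟩ := hj
    by_cases hl : l = k
    · subst hl; simp
    · simp [hl, Q.dir.injective.eq_iff]
  · have : j ≠ Q.dir k := fun h => hj ⟨k, h.symm⟩
    simp [vertex_of_notMem _ _ hj, this]

theorem vertex_update_false (Q : Cube q X) (k : Fin q) :
    Q.vertex (Function.update (fun _ => false) k true) = Q.edge k := by
  rw [vertex_update, vertex_false]
  funext j
  by_cases hj : j = Q.dir k
  · subst hj; simp [edge]
  · simp [edge, hj]

theorem adj_vertex_update (Q : Cube q X) (t : Fin q → Bool) (k : Fin q) (b : Bool)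
    (h : t k ≠ b) : Adj (Q.vertex t) (Q.vertex (Function.update t k b)) := by
  rw [adj_iff]
  refine ⟨Q.dir k, b.toInt - (t k).toInt, ?_, Q.vertex_update t k b⟩
  revert h
  cases b <;> cases t k <;> simp

/-- An elementary cube is determined by its points. -/
theorem points_injective : Function.Injective (points : Cube q X → Set (Fin n → ℤ)) := by
  intro Q R h
  -- Each corner lies in the other cube, so in every coordinate each is at least the other.
  have hc : Q.corner = R.corner := by
    funext j
    have h1 : Q.corner ∈ R.points := h ▸ Q.corner_mem
    have h2 : R.corner ∈ Q.points := h ▸ R.corner_mem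
    rcases h1 j with h1 | ⟨-, h1⟩ <;> rcases h2 j with h2 | ⟨-, h2⟩ <;> omega
  have key : ∀ {Q R : Cube q X}, Q.points = R.points → Q.corner = R.corner →
      Set.range Q.dir ⊆ Set.range R.dir := by
    rintro Q R h hc _ ⟨k, rfl⟩
    have h1 : Q.edge k ∈ R.points := h ▸ Q.edge_mem k
    rcases h1 (Q.dir k) with h1 | ⟨h1, -⟩
    · simp [edge, hc] at h1
    · exact h1
  exact Cube.ext hc (OrderEmbedding.range_inj.1 ((key h hc).antisymm (key h.symm hc.symm)))

/-! ### Faces in Boolean coordinates -/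

/-- The face of an elementary cube on which the `i`-th Boolean coordinate is `b`. -/
def face (Q : Cube (q + 1) X) (i : Fin (q + 1)) (b : Bool) : Cube q X :=
  if b then Q.backFace i else Q.frontFace i

@[simp]
theorem face_false (Q : Cube (q + 1) X) (i : Fin (q + 1)) : Q.face i false = Q.frontFace i := rfl

@[simp]
theorem face_true (Q : Cube (q + 1) X) (i : Fin (q + 1)) : Q.face i true = Q.backFace i := rfl

theorem face_dir (Q : Cube (q + 1) X) (i : Fin (q + 1)) (b : Bool) (k : Fin q) :
    (Q.face i b).dir k = Q.dir (i.succAbove k) := by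
  cases b <;> rfl

theorem face_corner (Q : Cube (q + 1) X) (i : Fin (q + 1)) (b : Bool) :
    (Q.face i b).corner = Q.corner + Pi.single (Q.dir i) b.toInt := by
  cases b
  · simp [frontFace]
  · funext j
    by_cases hj : j = Q.dir i
    · subst hj; simp [backFace, edge]
    · simp [backFace, edge, hj]

theorem vertex_face (Q : Cube (q + 1) X) (i : Fin (q + 1)) (b : Bool) (t : Fin q → Bool) :
    (Q.face i b).vertex t = Q.vertex (i.insertNth b t) := by
  funext j
  by_cases hj : j ∈ Set.range Q.dir
  · obtain ⟨k, rfl⟩ := hj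
    rw [vertex_dir]
    rcases Fin.eq_self_or_eq_succAbove i k with rfl | ⟨l, rfl⟩
    · rw [vertex_of_notMem, face_corner]
      · simp
      · rintro ⟨l, hl⟩
        rw [face_dir] at hl
        exact Fin.succAbove_ne _ _ (Q.dir.injective hl)
    · rw [← Q.face_dir i b, vertex_dir, face_corner]
      simp [face_dir, Q.dir.injective.eq_iff]
  · rw [vertex_of_notMem _ _ hj, vertex_of_notMem, face_corner]
    · have : j ≠ Q.dir i := fun h => hj ⟨i, h.symm⟩
      simp [this]
    · rintro ⟨k, rfl⟩
      exact hj ⟨_, (Q.face_dir i b k).symm⟩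

theorem face_points (Q : Cube (q + 1) X) (i : Fin (q + 1)) (b : Bool) :
    (Q.face i b).points = {v | ∃ t, t i = b ∧ Q.vertex t = v} := by
  rw [points_eq_range]
  ext v
  constructor
  · rintro ⟨t, rfl⟩
    exact ⟨_, by simp, (Q.vertex_face i b t).symm⟩
  · rintro ⟨t, rfl, rfl⟩
    exact ⟨i.removeNth t, by rw [vertex_face, Fin.insertNth_self_removeNth]⟩

end Cube

/-! ### Continuous functions that are injective on a cube -/

/-- An injective edge-preserving map of the vertices of a cube to `ℤᵐ` is affine. -/
theorem exists_affine {q m : ℕ} (g : (Fin q → Bool) → Fin m → ℤ) (hg : Function.Injective g)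
    (hadj : ∀ t k, t k = false → Adj (g t) (g (Function.update t k true))) :
    ∃ (σ : Fin q → Fin m) (ε : Fin q → ℤ), Function.Injective σ ∧ (∀ k, ε k = 1 ∨ ε k = -1) ∧
      ∀ t k, t k = false → g (Function.update t k true) = g t + Pi.single (σ k) (ε k) := by
  have h0 := fun k => adj_iff.1 (hadj (fun _ => false) k rfl)
  choose σ ε hε hσ using h0
  -- If the two edges at `t` are the steps taken at the zero vector, so is the edge across the
  -- square: the two ways around it are different walks with the same end points.
  have square : ∀ t k l, k ≠ l → t k = false → t l = false →
      g (Function.update t k true) = g t + Pi.single (σ k) (ε k) →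
      g (Function.update t l true) = g t + Pi.single (σ l) (ε l) →
      σ k ≠ σ l ∧ g (Function.update (Function.update t l true) k true) =
        g (Function.update t l true) + Pi.single (σ k) (ε k) := by
    intro t k l hkl hk hl ek el
    obtain ⟨p, a, ha, e1⟩ := adj_iff.1 (hadj (Function.update t l true) k (by simp [hkl, hk]))
    obtain ⟨r, b, hb, e2⟩ := adj_iff.1 (hadj (Function.update t k true) l (by simp [hkl.symm, hl]))
    have e3 := e1
    rw [Function.update_comm hkl.symm, e2, ek, el, add_assoc, add_assoc, add_right_inj] at e3
    -- The two side conditions come from injectivity of `g` on the opposite vertices of the square,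
    -- and on the two neighbours of `t`.
    obtain ⟨h1, h2, h3⟩ := single_add_single_eq (hε l) ha (hε k) hb e3.symm (fun h => by
        rw [el, add_assoc, h, add_zero] at e1
        have := congrFun (hg e1) k
        simp [hk] at this) (fun h => by
        rw [← add_right_inj (g t), ← el, ← ek] at h
        have := congrFun (hg h) k
        simp [hkl, hk] at this)
    exact ⟨h1.symm, by rw [e1, h2, h3]⟩
  refine ⟨σ, ε, fun k l h => ?_, hε, fun t => ?_⟩
  · by_contra hkl
    exact (square _ k l hkl rfl rfl (hσ k) (hσ l)).1 h
  · induction t using boolVec_induction with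
    | h0 => exact fun k _ => hσ k
    | hs t l hl ih =>
      intro k hk
      have hkl : k ≠ l := by rintro rfl; simp at hk
      rw [Function.update_of_ne hkl] at hk
      exact (square t k l hkl hk hl (ih k hk) (ih l hl)).2

/-! ### Signed permutations and cubes -/

/-- The action of a signed permutation on Boolean vectors. -/
def twist {q : ℕ} (τ : Equiv.Perm (Fin q)) (N t : Fin q → Bool) : Fin q → Bool :=
  fun p => xor (t (τ.symm p)) (N (τ.symm p))

@[simp]
theorem twist_apply {q : ℕ} (τ : Equiv.Perm (Fin q)) (N t : Fin q → Bool) (k : Fin q) :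
    twist τ N t (τ k) = xor (t k) (N k) := by
  simp [twist]

theorem twist_bijective {q : ℕ} (τ : Equiv.Perm (Fin q)) (N : Fin q → Bool) :
    Function.Bijective (twist τ N) := by
  refine Function.bijective_iff_has_inverse.2 ⟨fun s k => xor (s (τ k)) (N k), fun t => ?_,
    fun s => ?_⟩
  · funext k; simp
  · funext p; simp [twist]

theorem twist_update {q : ℕ} (τ : Equiv.Perm (Fin q)) (N t : Fin q → Bool) (k : Fin q) (b : Bool) :
    twist τ N (Function.update t k b) = Function.update (twist τ N t) (τ k) (xor b (N k)) := by
  funext p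
  obtain ⟨l, rfl⟩ := τ.surjective p
  by_cases h : l = k
  · subst h; simp
  · simp [h]

section

variable {q n m : ℕ} {X : Set (Fin n → ℤ)} {Y : Set (Fin m → ℤ)}

/-- The value of `f` at a vertex of an elementary cube. -/
def vertexMap (f : X → Y) (Q : Cube q X) (t : Fin q → Bool) : Fin m → ℤ :=
  f ⟨Q.vertex t, Q.vertex_mem t⟩

/-- `f` maps `Q` to `R` by the signed permutation `(τ, N)`. -/
def IsSignedPerm (f : X → Y) (Q : Cube q X) (R : Cube q Y) (τ : Equiv.Perm (Fin q))
    (N : Fin q → Bool) : Prop :=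
  ∀ t, vertexMap f Q t = R.vertex (twist τ N t)

theorem injOn_iff (f : X → Y) (Q : Cube q X) :
    Set.InjOn f {x | (x : Fin n → ℤ) ∈ Q.points} ↔ Function.Injective (vertexMap f Q) := by
  constructor
  · intro h t t' e
    have := h (Q.vertex_mem_points t) (Q.vertex_mem_points t') (Subtype.ext e)
    exact Q.vertex_injective (congrArg Subtype.val this)
  · rintro h ⟨x, hx⟩ hxQ ⟨y, hy⟩ hyQ e
    simp only [Set.mem_ofPred_eq, Cube.points_eq_range] at hxQ hyQ
    obtain ⟨t, rfl⟩ := hxQ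
    obtain ⟨t', rfl⟩ := hyQ
    have : t = t' := h (congrArg Subtype.val e)
    subst this
    rfl

theorem imagePoints_eq (f : X → Y) (Q : Cube q X) :
    imagePoints f Q = Set.range (vertexMap f Q) := by
  ext y
  constructor
  · rintro ⟨⟨x, hx⟩, hxQ, rfl⟩
    simp only [Cube.points_eq_range] at hxQ
    obtain ⟨t, rfl⟩ := hxQ
    exact ⟨t, rfl⟩
  · rintro ⟨t, rfl⟩
    exact ⟨⟨_, Q.vertex_mem t⟩, Q.vertex_mem_points t, rfl⟩

theorem IsContinuous.adjEq_vertexMap {f : X → Y} (hf : IsContinuous f) (Q : Cube q X)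
    (t : Fin q → Bool) (k : Fin q) (b : Bool) :
    AdjEq (vertexMap f Q t) (vertexMap f Q (Function.update t k b)) := by
  by_cases h : t k = b
  · subst h; simp [AdjEq]
  · exact hf _ _ (Q.adj_vertex_update t k b h)

/-- A continuous function that is injective on an elementary cube maps it to an elementary cube by
a signed permutation. -/
theorem exists_isSignedPerm {f : X → Y} (hf : IsContinuous f) (Q : Cube q X)
    (h : Function.Injective (vertexMap f Q)) :
    ∃ (R : Cube q Y) (τ : Equiv.Perm (Fin q)) (N : Fin q → Bool), IsSignedPerm f Q R τ N := by
  classical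
  obtain ⟨σ, ε, hσ, hε, hg⟩ := exists_affine (vertexMap f Q) h fun t k hk =>
    (hf.adjEq_vertexMap Q t k true).resolve_left fun e => by
      have := congrFun (h e) k
      simp [hk] at this
  -- The directions of the image cube must be listed increasingly; `τ` records the sorting of the
  -- values of `σ`, and `N` marks the reversed directions.
  let s : Finset (Fin m) := Finset.univ.image σ
  have hs : s.card = q := by simp [s, Finset.card_image_of_injective _ hσ]
  let dir : Fin q ↪o Fin m := s.orderEmbOfFin hs
  have hdir : Set.range dir = Set.range σ := by simp [dir, s]
  have hτ : ∀ k, ∃ p, dir p = σ k := fun k => by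
    have : σ k ∈ Set.range dir := hdir ▸ ⟨k, rfl⟩
    exact this
  choose τ₀ hτ₀ using hτ
  have hinj : Function.Injective τ₀ := fun k l e => hσ (by rw [← hτ₀, ← hτ₀, e])
  let τ : Equiv.Perm (Fin q) := Equiv.ofBijective τ₀ (Finite.injective_iff_bijective.1 hinj)
  have hτ' : ∀ k, dir (τ k) = σ k := hτ₀
  let N : Fin q → Bool := fun k => decide (ε k = -1)
  -- The ambient set is `univ` because containment in `Y` is only known after `key`. The corner is
  -- shifted since the image of the corner of `Q` has maximal coordinates in the reversed
  -- directions.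
  let R₀ : Cube q (Set.univ : Set (Fin m → ℤ)) :=
    ⟨vertexMap f Q (fun _ => false) -
      Function.extend dir (fun p => (twist τ N (fun _ => false) p).toInt) 0, dir,
      Set.subset_univ _⟩
  have key : ∀ t, vertexMap f Q t = R₀.vertex (twist τ N t) := by
    intro t
    induction t using boolVec_induction with
    | h0 => simp [R₀, Cube.vertex]
    | hs t k hk ih =>
      rw [hg t k hk, ih, twist_update, Cube.vertex_update, twist_apply, ← hτ' k]
      congr 2
      rcases hε k with e | e <;> simp [hk, N, e]
  have hR : R₀.points ⊆ Y := by
    rw [Cube.points_subset_iff]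
    intro t
    obtain ⟨t', rfl⟩ := (twist_bijective τ N).2 t
    rw [← key]
    exact Subtype.coe_prop _
  exact ⟨⟨R₀.corner, dir, hR⟩, τ, N, key⟩

theorem IsSignedPerm.injective {f : X → Y} {Q : Cube q X} {R : Cube q Y}
    {τ : Equiv.Perm (Fin q)} {N : Fin q → Bool} (h : IsSignedPerm f Q R τ N) :
    Function.Injective (vertexMap f Q) := by
  have : vertexMap f Q = R.vertex ∘ twist τ N := funext h
  rw [this]
  exact R.vertex_injective.comp (twist_bijective τ N).1

theorem IsSignedPerm.points_eq {f : X → Y} {Q : Cube q X} {R : Cube q Y}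
    {τ : Equiv.Perm (Fin q)} {N : Fin q → Bool} (h : IsSignedPerm f Q R τ N) :
    R.points = imagePoints f Q := by
  have : vertexMap f Q = R.vertex ∘ twist τ N := funext h
  rw [imagePoints_eq, this, (twist_bijective τ N).2.range_comp, Cube.points_eq_range]

/-- The matrix of a signed permutation. -/
def signedPermMatrix (τ : Equiv.Perm (Fin q)) (N : Fin q → Bool) : Matrix (Fin q) (Fin q) ℤ :=
  Matrix.of fun p k => if p = τ k then (if N k then -1 else 1) else 0

/-- An arbitrary base vertex `t` is allowed because the corner of a back face of `Q` is not the
corner of `Q`. -/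
theorem IsSignedPerm.sub_apply {f : X → Y} {Q : Cube q X} {R : Cube q Y}
    {τ : Equiv.Perm (Fin q)} {N : Fin q → Bool} (h : IsSignedPerm f Q R τ N) (t : Fin q → Bool)
    (k p : Fin q) (ht : t k = false) :
    vertexMap f Q (Function.update t k true) (R.dir p) - vertexMap f Q t (R.dir p) =
      signedPermMatrix τ N p k := by
  rw [h, h, twist_update, Cube.vertex_update, Pi.add_apply, add_sub_cancel_left, twist_apply, ht,
    Pi.single_apply]
  simp only [R.dir.injective.eq_iff, signedPermMatrix, Matrix.of_apply]
  cases N k <;> simp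

theorem orientation_eq (f : X → Y) (Q : Cube q X) (R : Cube q Y) :
    orientation f Q R = Matrix.det (Matrix.of fun p k : Fin q =>
      vertexMap f Q (Function.update (fun _ => false) k true) (R.dir p) -
        vertexMap f Q (fun _ => false) (R.dir p)) := by
  simp only [orientation, vertexMap, Cube.vertex_update_false, Cube.vertex_false]

theorem IsSignedPerm.orientation_eq {f : X → Y} {Q : Cube q X} {R : Cube q Y}
    {τ : Equiv.Perm (Fin q)} {N : Fin q → Bool} (h : IsSignedPerm f Q R τ N) :
    orientation f Q R = (signedPermMatrix τ N).det := by
  rw [DigitalHomology.orientation_eq]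
  congr 1
  ext p k
  exact h.sub_apply _ k p rfl

end

/-! ### Chains and faces -/

section

variable {q n : ℕ} {X : Set (Fin n → ℤ)}

/-- A span of basis elements consists of the chains supported on them, so membership can be tested
cube by cube. -/
theorem mem_chainsIn_iff {A : Set (Fin n → ℤ)} {c : Chain q X} :
    c ∈ chainsIn q X A ↔ ∀ Q, c Q ≠ 0 → Q.points ⊆ A := by
  have h : chainsIn q X A = Finsupp.supported ℤ ℤ {Q : Cube q X | Q.points ⊆ A} := by
    rw [Finsupp.supported_eq_span_single, chainsIn]
    congr 1
    ext c
    constructor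
    · rintro ⟨Q, hQ, rfl⟩; exact ⟨Q, hQ, rfl⟩
    · rintro ⟨Q, hQ, rfl⟩; exact ⟨Q, hQ, rfl⟩
  rw [h, Finsupp.mem_supported]
  simp [Set.subset_def]

/-- This is what confines a boundary to a wall, by bounding it from both sides. -/
theorem chainsIn_inter {A B : Set (Fin n → ℤ)} {c : Chain q X} (hA : c ∈ chainsIn q X A)
    (hB : c ∈ chainsIn q X B) : c ∈ chainsIn q X (A ∩ B) := by
  rw [mem_chainsIn_iff] at *
  exact fun Q h => Set.subset_inter (hA Q h) (hB Q h)

theorem chainsIn_mono {A B : Set (Fin n → ℤ)} (h : A ⊆ B) : chainsIn q X A ≤ chainsIn q X B := by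
  intro c hc
  rw [mem_chainsIn_iff] at *
  exact fun Q hQ => (hc Q hQ).trans h

theorem boundary_mem_chainsIn {A : Set (Fin n → ℤ)} {c : Chain (q + 1) X}
    (h : c ∈ chainsIn (q + 1) X A) : boundary q X c ∈ chainsIn q X A :=
  chainsIn_le_comap_boundary q X A h

theorem boundary_boundary (c : Chain (q + 2) X) : boundary q X (boundary (q + 1) X c) = 0 :=
  LinearMap.congr_fun (boundary_comp_boundary q X) c

theorem boundary_single (Q : Cube (q + 1) X) :
    boundary q X (Finsupp.single Q 1) = ∑ i : Fin (q + 1), (-1 : ℤ) ^ ((i : ℕ) + 1) •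
      (Finsupp.single (Q.face i false) 1 - Finsupp.single (Q.face i true) 1) := by
  simp [boundary]

namespace Cube

theorem range_dir_eq (Q : Cube (q + 1) X) (i : Fin (q + 1)) (b : Bool) :
    Set.range Q.dir = insert (Q.dir i) (Set.range (Q.face i b).dir) := by
  ext j
  simp only [Set.mem_range, Set.mem_insert_iff]
  constructor
  · rintro ⟨k, rfl⟩
    rcases Fin.eq_self_or_eq_succAbove i k with rfl | ⟨l, rfl⟩
    · exact Or.inl rfl
    · exact Or.inr ⟨l, Q.face_dir i b l⟩
  · rintro (rfl | ⟨l, rfl⟩)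
    · exact ⟨i, rfl⟩
    · exact ⟨_, (Q.face_dir i b l).symm⟩

end Cube

/-! ### Walls and half-spaces -/

/-- The half-space on the side `b` of the walls `vₖ = a` and `vₖ = a + 1`. -/
def halfSpace (k : Fin n) (a : ℤ) (b : Bool) : Set (Fin n → ℤ) :=
  {v | if b then a + 1 ≤ v k else v k ≤ a}

theorem vertex_apply_eq_of_points_eq {Q R : Cube q X} {k : Fin n} {a : ℤ}
    (h : ∀ v ∈ Q.points, v k = a) (e : Q = R) : ∀ t, R.vertex t k = a := by
  subst e
  exact fun t => h _ (Q.vertex_mem_points t)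

/-- A cube with a common face with `Q`, in a wall orthogonal to the face, that is not on the same
side of the wall as the face, is `Q`. -/
theorem eq_of_face_eq {Q G : Cube (q + 1) X} {i j : Fin (q + 1)} {b b' : Bool}
    (h : G.face j b' = Q.face i b)
    (hG : ¬ G.points ⊆ halfSpace (Q.dir i) (Q.corner (Q.dir i)) b) : G = Q ∧ j = i ∧ b' = b := by
  set k := Q.dir i with hk
  set a := Q.corner k with ha
  -- The common face lies in the wall `v k = a + b.toInt`, which belongs to the half-space.
  have hF : ∀ t, (G.face j b').vertex t k = a + b.toInt := by
    refine vertex_apply_eq_of_points_eq (fun v hv => ?_) h.symm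
    rw [Cube.face_points] at hv
    obtain ⟨t, rfl, rfl⟩ := hv
    simp [hk, ha]
  have hside : ∀ c : ℤ, c = a + b.toInt → if b then a + 1 ≤ c else c ≤ a := by
    rintro c rfl
    cases b <;> simp
  by_cases hkG : k ∈ Set.range G.dir
  · obtain ⟨l, hl⟩ := hkG
    rcases Fin.eq_self_or_eq_succAbove j l with rfl | ⟨l', rfl⟩
    · have h1 : G.corner k + b'.toInt = a + b.toInt := by
        rw [← hF (fun _ => false), Cube.vertex_false, Cube.face_corner]
        simp [hl]
      -- If the face were at the other end of `G`, then `G` would extend from the wall into the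
      -- half-space.
      have hb : b' = b := by
        by_contra hb
        refine hG (G.points_subset_iff.2 fun t => ?_)
        have h2 : G.vertex t k = G.corner k + (t l).toInt := by rw [← hl, Cube.vertex_dir]
        change if b then a + 1 ≤ G.vertex t k else G.vertex t k ≤ a
        rw [h2]
        revert hb h1
        cases b <;> cases b' <;> cases t l <;> simp <;> omega
      subst hb
      have hc : G.corner = Q.corner := by
        have := congrArg Cube.corner h
        rwa [Cube.face_corner, Cube.face_corner, hl, ← hk, add_left_inj] at this
      have hd : G.dir = Q.dir := by
        rw [← OrderEmbedding.range_inj, G.range_dir_eq l b', Q.range_dir_eq i b', h, hl]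
      have : G = Q := Cube.ext hc hd
      subst this
      exact ⟨rfl, G.dir.injective hl, rfl⟩
    -- Here `k` is a direction of the common face itself, which cannot then lie in a wall orthogonal
    -- to `k`.
    · exfalso
      have h1 := hF (fun _ => false)
      have h2 := hF (fun _ => true)
      rw [← hl, ← G.face_dir j b', Cube.vertex_dir] at h1 h2
      simp at h1 h2
      omega
  -- If `k` is not a direction of `G`, all of `G` lies in the wall, hence in the half-space.
  · refine absurd (G.points_subset_iff.2 fun t => hside _ ?_) hG
    rw [Cube.vertex_of_notMem _ _ hkG, ← hF (fun _ => false), Cube.vertex_face,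
      Cube.vertex_of_notMem _ _ hkG]

/-! ### Cycles have many vertices -/

/-- The augmentation of the chain complex. -/
def augmentation (X : Set (Fin n → ℤ)) : Chain 0 X →ₗ[ℤ] ℤ :=
  Finsupp.linearCombination ℤ fun _ => 1

theorem augmentation_boundary (c : Chain 1 X) : augmentation X (boundary 0 X c) = 0 := by
  induction c using Finsupp.induction_linear with
  | zero => simp
  | add c d hc hd => simp [hc, hd]
  | single Q a => simp [augmentation, boundary]

/-- Cycles of the augmented chain complex. -/
def IsReducedCycle : (q : ℕ) → Chain q X → Prop
  | 0, c => augmentation X c = 0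
  | q + 1, c => boundary q X c = 0

theorem isReducedCycle_boundary (c : Chain (q + 1) X) : IsReducedCycle q (boundary q X c) := by
  cases q with
  | zero => exact augmentation_boundary c
  | succ q => exact boundary_boundary c

theorem boundary_single_face_of_notSubset {Q G : Cube (q + 1) X} {i : Fin (q + 1)} {b : Bool}
    (hG : ¬ G.points ⊆ halfSpace (Q.dir i) (Q.corner (Q.dir i)) b) (hne : G ≠ Q) :
    boundary q X (Finsupp.single G 1) (Q.face i b) = 0 := by
  classical
  rw [boundary_single, Finsupp.finsetSum_apply]
  refine Finset.sum_eq_zero fun j _ => ?_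
  have h : ∀ b', G.face j b' ≠ Q.face i b := fun b' e => hne (eq_of_face_eq e hG).1
  simp [h, -Cube.face_false, -Cube.face_true]

theorem not_points_subset_halfSpace (Q : Cube (q + 1) X) (i : Fin (q + 1)) (b : Bool) :
    ¬ Q.points ⊆ halfSpace (Q.dir i) (Q.corner (Q.dir i)) b := by
  intro h
  have := h (Q.vertex_mem_points fun _ => !b)
  revert this
  cases b <;> simp [halfSpace]

/-- By `eq_of_face_eq` with `G = Q`, the faces of `Q` are pairwise different, so the coefficient is
a single sign without cancellation. -/
theorem boundary_single_face_ne_zero (Q : Cube (q + 1) X) (i : Fin (q + 1)) (b : Bool) :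
    boundary q X (Finsupp.single Q 1) (Q.face i b) ≠ 0 := by
  classical
  have h : ∀ j b', Q.face j b' = Q.face i b → j = i ∧ b' = b := fun j b' e =>
    (eq_of_face_eq e (not_points_subset_halfSpace Q i b)).2
  have h' : ∀ j b', Q.face j b' = Q.face i b ↔ j = i ∧ b' = b :=
    fun j b' => ⟨h j b', by rintro ⟨rfl, rfl⟩; rfl⟩
  rw [boundary_single, Finsupp.finsetSum_apply, Finset.sum_eq_single i]
  · cases b <;> simp [h', -Cube.face_false, -Cube.face_true]
  · intro j _ hj
    simp [h', hj, -Cube.face_false, -Cube.face_true]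
  · simp

/-- The part of a chain on one side of a cube in its support has a nonzero boundary. -/
theorem boundary_apply_face {c : Chain (q + 1) X} {Q : Cube (q + 1) X} {i : Fin (q + 1)} {b : Bool}
    (hc : ∀ G, c G ≠ 0 → ¬ G.points ⊆ halfSpace (Q.dir i) (Q.corner (Q.dir i)) b) :
    boundary q X c (Q.face i b) = c Q * boundary q X (Finsupp.single Q 1) (Q.face i b) := by
  -- In the coefficient of the face, expanded over the cubes of `c`, only `Q` contributes.
  have e : boundary q X c (Q.face i b) =
      c.sum fun G a => a * boundary q X (Finsupp.single G 1) (Q.face i b) := by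
    rw [boundary, Finsupp.linearCombination_apply, Finsupp.sum, Finsupp.finsetSum_apply]
    refine Finset.sum_congr rfl fun G _ => ?_
    simp only [Finsupp.smul_apply, smul_eq_mul, Finsupp.linearCombination_single, one_smul]
  rw [e, Finsupp.sum]
  refine Finset.sum_eq_single Q (fun G hG hne => ?_) fun h => ?_
  · rw [boundary_single_face_of_notSubset (hc G (Finsupp.mem_support_iff.1 hG)) hne, mul_zero]
  · rw [Finsupp.notMem_support_iff.1 h, zero_mul]

/-- A cube has width at most `1` in each coordinate, so one vertex outside the half-space keeps the
others from passing its bounding wall. -/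
theorem points_subset_of_not_subset_halfSpace {G : Cube q X} {k : Fin n} {a : ℤ} {b : Bool}
    (h : ¬ G.points ⊆ halfSpace k a b) :
    G.points ⊆ {v | if b then v k ≤ a + 1 else a ≤ v k} := by
  rw [Cube.points_subset_iff] at *
  push Not at h
  obtain ⟨t, ht⟩ := h
  intro t'
  have key : ∀ t t', G.vertex t k ≤ G.vertex t' k + 1 := by
    intro t t'
    by_cases hk : k ∈ Set.range G.dir
    · obtain ⟨l, rfl⟩ := hk
      rw [Cube.vertex_dir, Cube.vertex_dir]
      cases t l <;> cases t' l <;> simp [add_assoc]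
    · rw [Cube.vertex_of_notMem _ _ hk, Cube.vertex_of_notMem _ _ hk]
      omega
  have h1 := key t t'
  have h2 := key t' t
  revert ht
  cases b <;> simp [halfSpace] <;> omega

theorem of_filter_apply_ne_zero {α : Type*} {p : α → Prop} [DecidablePred p] {z : α →₀ ℤ} {a : α}
    (h : z.filter p a ≠ 0) : p a := by
  by_contra ha
  exact h (Finsupp.filter_apply_neg p z ha)

/-- A nonzero reduced `q`-cycle has at least `2 ^ (q + 1)` vertices. -/
theorem IsReducedCycle.two_pow_le_card : ∀ {q : ℕ} {z : Chain q X}, IsReducedCycle q z → z ≠ 0 →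
    ∀ S : Finset (Fin n → ℤ), z ∈ chainsIn q X S → 2 ^ (q + 1) ≤ S.card := by
  classical
  intro q
  induction q with
  | zero =>
    intro z hz h0 S hS
    rw [mem_chainsIn_iff] at hS
    obtain ⟨Q, hQ⟩ := Finsupp.ne_iff.1 h0
    -- With a single point in the support, the augmentation would be its nonzero coefficient.
    obtain ⟨R, hR, hne⟩ : ∃ R, z R ≠ 0 ∧ R ≠ Q := by
      by_contra! h
      apply hQ
      have e : augmentation X z = z Q := by
        simp only [augmentation, Finsupp.linearCombination_apply, smul_eq_mul, mul_one, Finsupp.sum]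
        refine Finset.sum_eq_single Q (fun R hR hne => ?_) (by simp)
        exact absurd (h R (Finsupp.mem_support_iff.1 hR)) hne
      rw [← e]
      exact hz
    have : 1 < S.card := by
      refine Finset.one_lt_card.2 ⟨_, hS R hR R.corner_mem, _, hS Q hQ Q.corner_mem, fun e => ?_⟩
      exact hne (Cube.ext e (RelEmbedding.ext fun i => i.elim0))
    simpa using Nat.succ_le_of_lt this
  | succ q ih =>
    intro z hz h0 S hS
    obtain ⟨Q, hQ⟩ := Finsupp.ne_iff.1 h0
    set k := Q.dir 0 with hk
    set a := Q.corner k with ha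
    -- The walls `v k = a` and `v k = a + 1` through the two ends of `Q` are treated alike. The part
    -- `y` of `z` in the half-space and the remainder `r`, which contains `Q`, have opposite
    -- boundaries.
    have half : ∀ b : Bool, 2 ^ (q + 1) ≤ (S.filter fun v => v k = a + b.toInt).card := by
      intro b
      set y := z.filter fun G => G.points ⊆ halfSpace k a b with hy
      set r := z.filter fun G => ¬ G.points ⊆ halfSpace k a b with hr
      have hyr : y + r = z := Finsupp.filter_add_filter_not z _
      have hb : boundary q X y = - boundary q X r := by
        rw [eq_neg_iff_add_eq_zero, ← map_add, hyr]
        exact hz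
      have hyS : y ∈ chainsIn (q + 1) X (S ∩ halfSpace k a b) := by
        rw [mem_chainsIn_iff] at hS ⊢
        intro G hG
        have h : G.points ⊆ halfSpace k a b :=
          of_filter_apply_ne_zero (p := fun G : Cube (q + 1) X => G.points ⊆ halfSpace k a b) hG
        rw [hy, Finsupp.filter_apply_pos
          (fun G : Cube (q + 1) X => G.points ⊆ halfSpace k a b) _ h] at hG
        exact Set.subset_inter (hS G hG) h
      have hr' : ∀ G, r G ≠ 0 → ¬ G.points ⊆ halfSpace k a b := fun G hG =>
        of_filter_apply_ne_zero (p := fun G : Cube (q + 1) X => ¬ G.points ⊆ halfSpace k a b) hG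
      have hrS : r ∈ chainsIn (q + 1) X {v | if b then v k ≤ a + 1 else a ≤ v k} := by
        rw [mem_chainsIn_iff]
        exact fun G hG => points_subset_of_not_subset_halfSpace (hr' G hG)
      -- The cycle `∂y = -∂r` lies on both sides of the wall, hence in it. It is nonzero because in
      -- `r` only `Q` has the face `Q.face 0 b`.
      refine ih (isReducedCycle_boundary y) (fun h => ?_) _ (chainsIn_mono ?_
        (chainsIn_inter (boundary_mem_chainsIn hyS)
          (hb ▸ neg_mem (boundary_mem_chainsIn hrS) : boundary q X y ∈ _)))
      · rw [hb, neg_eq_zero] at h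
        have e := boundary_apply_face (c := r) (Q := Q) (i := 0) (b := b) hr'
        rw [h, hr, Finsupp.filter_apply_pos (fun G : Cube (q + 1) X => ¬ G.points ⊆ halfSpace k a b) _
          (not_points_subset_halfSpace Q 0 b)] at e
        exact mul_ne_zero hQ (boundary_single_face_ne_zero Q 0 b) e.symm
      · rintro v ⟨⟨h1, h2⟩, h3⟩
        simp only [Finset.coe_filter, Set.mem_ofPred_eq, halfSpace] at h1 h2 h3 ⊢
        refine ⟨h1, ?_⟩
        revert h2 h3
        cases b <;> simp <;> omega
    have h1 := half false
    have h2 := half true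
    have hd : Disjoint (S.filter fun v => v k = a + false.toInt)
        (S.filter fun v => v k = a + true.toInt) := by
      rw [Finset.disjoint_filter]
      intro v _ h
      simp [h]
    have h3 := Finset.card_le_card (Finset.union_subset (Finset.filter_subset
      (fun v => v k = a + false.toInt) S) (Finset.filter_subset (fun v => v k = a + true.toInt) S))
    rw [Finset.card_union_of_disjoint hd] at h3
    rw [pow_succ]
    omega

end

/-! ### Induced homomorphisms of chain groups -/

section

variable {q n m l : ℕ} {X : Set (Fin n → ℤ)} {Y : Set (Fin m → ℤ)} {Z : Set (Fin l → ℤ)}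

theorem cubeMap_eq_single (f : X → Y) {Q : Cube q X} {R : Cube q Y}
    (h : Function.Injective (vertexMap f Q)) (hR : R.points = imagePoints f Q) :
    cubeMap f Q = Finsupp.single R (orientation f Q R) := by
  have H : Set.InjOn f {x | (x : Fin n → ℤ) ∈ Q.points} ∧
    ∃ R : Cube q Y, R.points = imagePoints f Q := ⟨(injOn_iff f Q).2 h, R, hR⟩
  have e : H.2.choose = R := Cube.points_injective (H.2.choose_spec.trans hR.symm)
  rw [cubeMap, dif_pos H, e]

theorem cubeMap_eq_zero (f : X → Y) {Q : Cube q X}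
    (h : ¬ Function.Injective (vertexMap f Q)) : cubeMap f Q = 0 := by
  rw [cubeMap, dif_neg]
  exact fun H => h ((injOn_iff f Q).1 H.1)

theorem IsSignedPerm.cubeMap_eq {f : X → Y} {Q : Cube q X} {R : Cube q Y}
    {τ : Equiv.Perm (Fin q)} {N : Fin q → Bool} (h : IsSignedPerm f Q R τ N) :
    cubeMap f Q = Finsupp.single R (signedPermMatrix τ N).det := by
  rw [cubeMap_eq_single f h.injective h.points_eq, h.orientation_eq]

@[simp]
theorem chainMap_single (f : X → Y) (Q : Cube q X) (a : ℤ) :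
    chainMap q f (Finsupp.single Q a) = a • cubeMap f Q := by
  simp [chainMap]

theorem cubeMap_mem_chainsIn (f : X → Y) (Q : Cube q X) :
    cubeMap f Q ∈ chainsIn q Y (imagePoints f Q) := by
  rw [cubeMap]
  split_ifs with h
  · rw [← mul_one (orientation _ _ _), ← smul_eq_mul, ← Finsupp.smul_single]
    exact Submodule.smul_mem _ _ (single_mem_chainsIn _ h.2.choose_spec.le)
  · exact Submodule.zero_mem _

theorem vertexMap_comp (g : Y → Z) {f : X → Y} {Q : Cube q X} {R : Cube q Y}
    {τ : Equiv.Perm (Fin q)} {N : Fin q → Bool} (h : IsSignedPerm f Q R τ N) (t : Fin q → Bool) :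
    vertexMap (g ∘ f) Q t = vertexMap g R (twist τ N t) := by
  have e : f ⟨Q.vertex t, Q.vertex_mem t⟩ = ⟨R.vertex (twist τ N t), R.vertex_mem _⟩ :=
    Subtype.ext (h t)
  simp only [vertexMap, Function.comp_apply, e]

theorem signedPermMatrix_mul (τ τ' : Equiv.Perm (Fin q)) (N N' : Fin q → Bool) :
    signedPermMatrix τ' N' * signedPermMatrix τ N =
      signedPermMatrix (τ.trans τ') fun k => xor (N k) (N' (τ k)) := by
  ext p k
  simp only [Matrix.mul_apply, signedPermMatrix, Matrix.of_apply]
  rw [Finset.sum_eq_single (τ k) (by intro r _ hr; simp [hr]) (by simp)]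
  simp only [Equiv.trans_apply]
  split_ifs <;> simp_all

/-- Where both maps are injective, the signs multiply as determinants do. Otherwise `g ∘ f` is not
injective on the cube either, since a signed permutation is a bijection of vertices, and both sides
are `0`. -/
theorem chainMap_comp (q : ℕ) {g : Y → Z} {f : X → Y} (hg : IsContinuous g)
    (hf : IsContinuous f) (c : Chain q X) :
    chainMap q (g ∘ f) c = chainMap q g (chainMap q f c) := by
  suffices h : chainMap q (g ∘ f) = chainMap q g ∘ₗ chainMap q f from LinearMap.congr_fun h c
  refine Finsupp.lhom_ext' fun Q => LinearMap.ext_ring ?_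
  simp only [LinearMap.comp_apply, Finsupp.lsingle_apply, chainMap_single, one_smul]
  by_cases h : Function.Injective (vertexMap f Q)
  · obtain ⟨R, τ, N, hR⟩ := exists_isSignedPerm hf Q h
    rw [hR.cubeMap_eq, chainMap_single]
    have e : vertexMap (g ∘ f) Q = vertexMap g R ∘ twist τ N := funext (vertexMap_comp g hR)
    by_cases h' : Function.Injective (vertexMap g R)
    · obtain ⟨S, τ', N', hS⟩ := exists_isSignedPerm hg R h'
      have hc : IsSignedPerm (g ∘ f) Q S (τ.trans τ') fun k => xor (N k) (N' (τ k)) := by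
        intro t
        rw [e, Function.comp_apply, hS]
        congr 1
        funext p
        obtain ⟨k, rfl⟩ := (τ.trans τ').surjective p
        rw [twist_apply]
        simp
      rw [hS.cubeMap_eq, hc.cubeMap_eq, ← signedPermMatrix_mul, Matrix.det_mul,
        Finsupp.smul_single, smul_eq_mul, mul_comm]
    · rw [cubeMap_eq_zero g h', smul_zero, cubeMap_eq_zero]
      rw [e]
      exact fun hi => h' ((Function.Injective.of_comp_iff' _ (twist_bijective τ N)).1 hi)
  · rw [cubeMap_eq_zero f h, map_zero, cubeMap_eq_zero]
    refine fun hi => h fun t t' ht => hi ?_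
    have : f ⟨Q.vertex t, Q.vertex_mem t⟩ = f ⟨Q.vertex t', Q.vertex_mem t'⟩ := Subtype.ext ht
    simp only [vertexMap, Function.comp_apply, this]

/-- The induced chain of a face of a cube on which `f` is a signed permutation. -/
theorem IsSignedPerm.cubeMap_face {f : X → Y} {Q : Cube (q + 1) X} {R : Cube (q + 1) Y}
    {τ : Equiv.Perm (Fin (q + 1))} {N : Fin (q + 1) → Bool} (h : IsSignedPerm f Q R τ N)
    (i : Fin (q + 1)) (b : Bool) :
    cubeMap f (Q.face i b) = Finsupp.single (R.face (τ i) (xor b (N i)))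
      ((signedPermMatrix τ N).submatrix (τ i).succAbove i.succAbove).det := by
  have hv : ∀ t, vertexMap f (Q.face i b) t = vertexMap f Q (i.insertNth b t) := by
    intro t
    simp only [vertexMap, Cube.vertex_face]
  rw [cubeMap_eq_single f (R := R.face (τ i) (xor b (N i)))]
  · rw [DigitalHomology.orientation_eq]
    congr 2
    ext p k
    rw [Matrix.of_apply, Matrix.submatrix_apply, hv, hv, Cube.face_dir,
      ← h.sub_apply (i.insertNth b fun _ => false) _ _ (by simp), Fin.insertNth_update]
  · intro t t' e
    rw [hv, hv] at e
    have := h.injective e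
    funext k
    simpa using congrFun this (i.succAbove k)
  · rw [Cube.face_points, imagePoints_eq]
    ext v
    constructor
    · rintro ⟨t, ht, rfl⟩
      obtain ⟨s, rfl⟩ := (twist_bijective τ N).2 t
      refine ⟨i.removeNth s, ?_⟩
      have : s i = b := by simpa using ht
      rw [hv, ← this, Fin.insertNth_self_removeNth, h]
    · rintro ⟨t, rfl⟩
      rw [hv, h]
      exact ⟨_, by simp, rfl⟩

/-- The sign of `f` on a face of `Q` is a minor of the signed permutation matrix, so the two sides
agree by expanding the determinant along a column. -/
theorem IsSignedPerm.boundary_chainMap {f : X → Y} {Q : Cube (q + 1) X} {R : Cube (q + 1) Y}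
    {τ : Equiv.Perm (Fin (q + 1))} {N : Fin (q + 1) → Bool} (h : IsSignedPerm f Q R τ N) :
    boundary q Y (cubeMap f Q) = chainMap q f (boundary q X (Finsupp.single Q 1)) := by
  have hdet : ∀ i, (signedPermMatrix τ N).det = (-1) ^ ((τ i : ℕ) + (i : ℕ)) *
      (if N i then -1 else 1) *
        ((signedPermMatrix τ N).submatrix (τ i).succAbove i.succAbove).det := by
    -- Column `i` has its only nonzero entry in row `τ i`.
    intro i
    rw [Matrix.det_succ_column _ i, Finset.sum_eq_single (τ i)]
    · simp [signedPermMatrix]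
    · intro p _ hp
      simp [signedPermMatrix, hp]
    · simp
  rw [h.cubeMap_eq, ← mul_one (Matrix.det _), ← smul_eq_mul, ← Finsupp.smul_single, map_smul,
    boundary_single, boundary_single, map_sum, Finset.smul_sum]
  rw [← Equiv.sum_comp τ]
  refine Finset.sum_congr rfl fun i _ => ?_
  rw [map_smul, map_sub, chainMap_single, chainMap_single, h.cubeMap_face, h.cubeMap_face, hdet i]
  set D := ((signedPermMatrix τ N).submatrix (τ i).succAbove i.succAbove).det
  have hs : ∀ S : Cube q Y, Finsupp.single S D = D • Finsupp.single S (1 : ℤ) := fun S => by simp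
  simp only [hs, smul_smul, ← smul_sub]
  have hp : (-1 : ℤ) ^ ((τ i : ℕ) + (i : ℕ)) * (-1) ^ ((τ i : ℕ) + 1) = (-1) ^ ((i : ℕ) + 1) := by
    rw [← pow_add, show (τ i : ℕ) + i + (τ i + 1) = 2 * (τ i : ℕ) + (i + 1) by ring, pow_add,
      pow_mul]
    simp
  rw [← hp]
  -- When direction `i` is reversed, front and back faces are exchanged, which cancels the entry
  -- `-1` of the matrix.
  cases N i
  · simp only [Bool.xor_false, Bool.false_eq_true, if_false]
    module
  · simp only [Bool.xor_true, if_true, Bool.not_false, Bool.not_true]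
    module

theorem augmentation_chainMap (f : X → Y) (c : Chain 0 X) :
    augmentation Y (chainMap 0 f c) = augmentation X c := by
  induction c using Finsupp.induction_linear with
  | zero => simp
  | add c d hc hd => simp [hc, hd]
  | single Q a =>
    -- A `0`-cube never degenerates, and its sign is the determinant of the empty matrix.
    let R : Cube 0 Y := ⟨vertexMap f Q (fun _ => false), ⟨⟨fun i => i.elim0, fun i => i.elim0⟩,
      fun {i} => i.elim0⟩, fun v hv => by
        have : v = vertexMap f Q (fun _ => false) := by
          funext j
          rcases hv j with h | ⟨⟨i, -⟩, -⟩
          · exact h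
          · exact i.elim0
        rw [this]
        exact Subtype.coe_prop _⟩
    have hR : IsSignedPerm f Q R 1 (fun _ => false) := by
      intro t
      rw [Subsingleton.elim (twist _ _ t) (fun _ => false), Subsingleton.elim t (fun _ => false),
        R.vertex_false]
    rw [chainMap_single, hR.cubeMap_eq]
    simp [augmentation]

theorem chainMap_mem_chainsIn (f : X → Y) {A : Set (Fin n → ℤ)} {B : Set (Fin m → ℤ)}
    (h : ∀ x : X, (x : Fin n → ℤ) ∈ A → (f x : Fin m → ℤ) ∈ B) {c : Chain q X}
    (hc : c ∈ chainsIn q X A) : chainMap q f c ∈ chainsIn q Y B := by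
  suffices chainsIn q X A ≤ (chainsIn q Y B).comap (chainMap q f) from this hc
  refine Submodule.span_le.2 ?_
  rintro _ ⟨Q, hQ, rfl⟩
  rw [SetLike.mem_coe, Submodule.mem_comap, chainMap_single, one_smul]
  refine chainsIn_mono ?_ (cubeMap_mem_chainsIn f Q)
  rintro y ⟨x, hx, rfl⟩
  exact h x (hQ hx)

/-- In the degenerate case the chain on the right is a reduced cycle with too few vertices to be
nonzero. The hypothesis `hz` is supplied by commutation in the degree below. -/
theorem boundary_chainMap_single {f : X → Y} (hf : IsContinuous f) (Q : Cube (q + 1) X)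
    (hz : IsReducedCycle q (chainMap q f (boundary q X (Finsupp.single Q 1)))) :
    boundary q Y (cubeMap f Q) = chainMap q f (boundary q X (Finsupp.single Q 1)) := by
  classical
  by_cases h : Function.Injective (vertexMap f Q)
  · obtain ⟨R, τ, N, hR⟩ := exists_isSignedPerm hf Q h
    exact hR.boundary_chainMap
  · rw [cubeMap_eq_zero f h, map_zero, eq_comm]
    by_contra h0
    have hS := hz.two_pow_le_card h0 (Finset.univ.image (vertexMap f Q)) (by
      refine chainMap_mem_chainsIn f (A := Q.points) ?_
        (boundary_mem_chainsIn (single_mem_chainsIn Q subset_rfl))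
      intro x hx
      rw [Finset.coe_image, Finset.coe_univ, Set.image_univ, ← imagePoints_eq]
      exact ⟨x, hx, rfl⟩)
    -- A non-injective map on the `2 ^ (q + 1)` Boolean vectors misses this cardinality.
    have hcard : (Finset.univ.image (vertexMap f Q)).card < 2 ^ (q + 1) := by
      refine lt_of_le_of_ne (Finset.card_image_le.trans (by simp)) fun e => h ?_
      rw [← Set.injOn_univ, ← Finset.coe_univ, ← Finset.card_image_iff, e]
      simp
    omega

/-- Induced homomorphisms of chain groups commute with the boundary operators. -/
theorem boundary_chainMap (q : ℕ) {f : X → Y} (hf : IsContinuous f) (c : Chain (q + 1) X) :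
    boundary q Y (chainMap (q + 1) f c) = chainMap q f (boundary q X c) := by
  have key : ∀ q, (∀ Q : Cube (q + 1) X,
      IsReducedCycle q (chainMap q f (boundary q X (Finsupp.single Q 1)))) →
      ∀ c : Chain (q + 1) X,
        boundary q Y (chainMap (q + 1) f c) = chainMap q f (boundary q X c) := by
    intro q h
    have e : boundary q Y ∘ₗ chainMap (q + 1) f = chainMap q f ∘ₗ boundary q X := by
      refine Finsupp.lhom_ext' fun Q => LinearMap.ext_ring ?_
      simpa using boundary_chainMap_single hf Q (h Q)
    exact LinearMap.congr_fun e
  induction q with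
  | zero => exact key 0 (fun Q => (augmentation_chainMap f _).trans (augmentation_boundary _)) c
  | succ q ih =>
    refine key (q + 1) (fun Q => ?_) c
    -- Commutation one degree lower turns `∂f∂Q` into `f∂∂Q = 0`.
    rw [IsReducedCycle, ih, boundary_boundary, map_zero]

end

/-! ### Inclusions and restrictions of chains -/

section

variable {q n : ℕ} {X B : Set (Fin n → ℤ)}

/-- An elementary cube in `B` as an elementary cube in a set that contains its points. -/
def Cube.copy (Q : Cube q B) {X : Set (Fin n → ℤ)} (h : Q.points ⊆ X) : Cube q X :=
  ⟨Q.corner, Q.dir, h⟩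

theorem Cube.points_subset (Q : Cube q X) : Q.points ⊆ X := Q.subset

theorem mem_chainsIn_empty {c : Chain q X} : c ∈ chainsIn q X ∅ ↔ c = 0 := by
  constructor
  · intro h
    rw [mem_chainsIn_iff] at h
    ext Q
    by_contra hQ
    exact h Q hQ Q.corner_mem
  · rintro rfl
    exact zero_mem _

theorem mem_chainsIn_univ (c : Chain q X) : c ∈ chainsIn q X X :=
  mem_chainsIn_iff.2 fun Q _ => Q.subset

theorem signedPermMatrix_one :
    signedPermMatrix (1 : Equiv.Perm (Fin q)) (fun _ => false) = 1 := by
  ext p k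
  simp [signedPermMatrix, Matrix.one_apply]

theorem twist_one (t : Fin q → Bool) : twist 1 (fun _ => false) t = t := by
  funext p
  exact Bool.xor_false _

/-- The induced chain of a cube for an inclusion. -/
theorem cubeMap_of_coe_eq {f : B → X} (hf : ∀ x, (f x : Fin n → ℤ) = x) (hB : B ⊆ X)
    (Q : Cube q B) : cubeMap f Q = Finsupp.single (Q.copy (Q.points_subset.trans hB)) 1 := by
  have h : IsSignedPerm f Q (Q.copy (Q.points_subset.trans hB)) 1 (fun _ => false) := by
    intro t
    have : twist 1 (fun _ => false) t = t := by 
      funext p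
      exact Bool.xor_false _
    rw [vertexMap, hf, this]
    rfl
  rw [h.cubeMap_eq]
  rw [signedPermMatrix_one, Matrix.det_one]

theorem chainMap_of_coe_eq {f : X → X} (hf : ∀ x, (f x : Fin n → ℤ) = x) (c : Chain q X) :
    chainMap q f c = c := by
  induction c using Finsupp.induction_linear with
  | zero => simp
  | add c d hc hd => simp [hc, hd]
  | single Q a =>
    rw [chainMap_single, cubeMap_of_coe_eq hf subset_rfl, Finsupp.smul_single, smul_eq_mul, mul_one]
    rfl

/-! ### Restriction of chains to a subset -/

open scoped Classical in
/-- The restriction of a chain to the cubes in `B`. -/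
def restrictChain (q : ℕ) (X B : Set (Fin n → ℤ)) : Chain q X →ₗ[ℤ] Chain q B :=
  Finsupp.linearCombination ℤ fun Q =>
    if h : Q.points ⊆ B then Finsupp.single (Q.copy h) 1 else 0

theorem restrictChain_single_of_subset {Q : Cube q X} (h : Q.points ⊆ B) (a : ℤ) :
    restrictChain q X B (Finsupp.single Q a) = Finsupp.single (Q.copy h) a := by
  simp [restrictChain, h]

theorem restrictChain_single_of_not_subset {Q : Cube q X} (h : ¬ Q.points ⊆ B) (a : ℤ) :
    restrictChain q X B (Finsupp.single Q a) = 0 := by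
  simp [restrictChain, h]

/-- With `chainMap_restrictChain` this identifies the chains of `B` with the chains of `X` supported
in `B`. -/
theorem restrictChain_chainMap {f : B → X} (hf : ∀ x, (f x : Fin n → ℤ) = x) (hB : B ⊆ X)
    (c : Chain q B) : restrictChain q X B (chainMap q f c) = c := by
  induction c using Finsupp.induction_linear with
  | zero => simp
  | add c d hc hd => simp [hc, hd]
  | single Q a =>
    rw [chainMap_single, cubeMap_of_coe_eq hf hB, Finsupp.smul_single, smul_eq_mul, mul_one]
    exact restrictChain_single_of_subset (Q := Q.copy (Q.points_subset.trans hB)) Q.points_subset a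

theorem chainsIn_induction {A : Set (Fin n → ℤ)} {p : Chain q X → Prop} (h0 : p 0)
    (hadd : ∀ c d, p c → p d → p (c + d)) (hs : ∀ Q a, Q.points ⊆ A → p (Finsupp.single Q a))
    {c : Chain q X} (hc : c ∈ chainsIn q X A) : p c := by
  rw [mem_chainsIn_iff] at hc
  rw [← Finsupp.sum_single c]
  exact Finset.sum_induction _ p hadd h0 fun Q hQ => hs Q _ (hc Q (Finsupp.mem_support_iff.1 hQ))

theorem chainMap_restrictChain {f : B → X} (hf : ∀ x, (f x : Fin n → ℤ) = x) (hB : B ⊆ X)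
    {c : Chain q X} (hc : c ∈ chainsIn q X B) : chainMap q f (restrictChain q X B c) = c := by
  refine chainsIn_induction (p := fun c => chainMap q f (restrictChain q X B c) = c) (by simp)
    (fun c d hc hd => by simp [hc, hd]) (fun Q a h => ?_) hc
  rw [restrictChain_single_of_subset h, chainMap_single, cubeMap_of_coe_eq hf hB,
    Finsupp.smul_single, smul_eq_mul, mul_one]
  rfl

theorem restrictChain_mem_chainsIn {A : Set (Fin n → ℤ)} {c : Chain q X}
    (hc : c ∈ chainsIn q X A) : restrictChain q X B c ∈ chainsIn q B (A ∩ B) := by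
  refine chainsIn_induction (p := fun c => restrictChain q X B c ∈ chainsIn q B (A ∩ B)) (by simp)
    (fun c d hc hd => by rw [map_add]; exact add_mem hc hd) (fun Q a h => ?_) hc
  by_cases hB : Q.points ⊆ B
  · rw [restrictChain_single_of_subset hB, ← mul_one a, ← smul_eq_mul, ← Finsupp.smul_single]
    exact Submodule.smul_mem _ _ (single_mem_chainsIn _ (Set.subset_inter h hB))
  · rw [restrictChain_single_of_not_subset hB]
    exact zero_mem _

theorem restrictChain_eq_zero {c : Chain q X} (hc : c ∈ chainsIn q X Bᶜ) :
    restrictChain q X B c = 0 := by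
  have := restrictChain_mem_chainsIn (B := B) hc
  rwa [Set.compl_inter_self, mem_chainsIn_empty] at this

theorem isContinuous_of_coe_eq {f : B → X} (hf : ∀ x, (f x : Fin n → ℤ) = x) :
    IsContinuous f := by
  intro x x' h
  rw [hf, hf]
  exact Or.inr h

/-- On chains in `B`, restriction inverts the inclusion, which is a chain map. The support condition
matters: a cube outside `B` may have faces in `B`. -/
theorem boundary_restrictChain (hB : B ⊆ X) {c : Chain (q + 1) X}
    (hc : c ∈ chainsIn (q + 1) X B) :
    boundary q B (restrictChain (q + 1) X B c) = restrictChain q X B (boundary q X c) := by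
  let f : B → X := Set.inclusion hB
  have hf : ∀ x, (f x : Fin n → ℤ) = x := fun _ => rfl
  rw [← restrictChain_chainMap hf hB (boundary q B _),
    ← boundary_chainMap q (isContinuous_of_coe_eq hf), chainMap_restrictChain hf hB hc]

theorem mem_chainsIn_of_chainMap {f : B → X} (hf : ∀ x, (f x : Fin n → ℤ) = x) (hB : B ⊆ X)
    {A : Set (Fin n → ℤ)} {c : Chain q B} (h : chainMap q f c ∈ chainsIn q X A) :
    c ∈ chainsIn q B (A ∩ B) := by
  rw [← restrictChain_chainMap hf hB c]
  exact restrictChain_mem_chainsIn h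

end

/-! ### Homology classes of chains -/

section

variable {q : ℕ} {P Q : DigitalPair}

/-- The chains that represent relative cycles. -/
def chainCycles (q : ℕ) (P : DigitalPair) : Submodule ℤ (Chain q P.X) :=
  (relCycles q P).comap (chainsIn q P.X P.A).mkQ

theorem mem_chainCycles_zero (c : Chain 0 P.X) : c ∈ chainCycles 0 P :=
  Submodule.mem_top (R := ℤ) (x := (chainsIn 0 P.X P.A).mkQ c)

theorem mem_chainCycles_succ {c : Chain (q + 1) P.X} :
    c ∈ chainCycles (q + 1) P ↔ boundary q P.X c ∈ chainsIn q P.X P.A := by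
  change relBoundary q P (Submodule.Quotient.mk c) = 0 ↔ _
  rw [relBoundary, Submodule.mapQ_apply, Submodule.Quotient.mk_eq_zero]

/-- The homology class of a chain that represents a relative cycle. -/
def chainClass (q : ℕ) (P : DigitalPair) : chainCycles q P →+ C1Homology q P :=
  AddMonoidHom.mk' (fun c => homologyClass (Submodule.Quotient.mk (c : Chain q P.X)) c.2)
    fun _ _ => rfl

theorem chainClass_surjective : Function.Surjective (chainClass q P) := by
  intro h
  obtain ⟨⟨z, hz⟩, rfl⟩ := Submodule.Quotient.mk_surjective _ h
  obtain ⟨c, rfl⟩ := Submodule.Quotient.mk_surjective _ z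
  exact ⟨⟨c, hz⟩, rfl⟩

/-- Lifting a relative boundary to chains of `X` leaves an error in the chains of `A`. This
criterion replaces the two nested quotients in all that follows. -/
theorem chainClass_eq_zero_iff {c : chainCycles q P} :
    chainClass q P c = 0 ↔
      ∃ e, (c : Chain q P.X) - boundary q P.X e ∈ chainsIn q P.X P.A := by
  have h : chainClass q P c = 0 ↔
      (Submodule.Quotient.mk (c : Chain q P.X) : RelChain q P) ∈
        LinearMap.range (relBoundary q P) :=
    Submodule.Quotient.mk_eq_zero _
  rw [h]
  constructor
  · rintro ⟨e, he⟩
    obtain ⟨e, rfl⟩ := Submodule.Quotient.mk_surjective _ e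
    exact ⟨e, (Submodule.Quotient.eq _).1 he.symm⟩
  · rintro ⟨e, he⟩
    exact ⟨Submodule.Quotient.mk e, ((Submodule.Quotient.eq _).2 he).symm⟩

theorem chainClass_eq_iff {c d : chainCycles q P} :
    chainClass q P c = chainClass q P d ↔
      ∃ e, (c : Chain q P.X) - d - boundary q P.X e ∈ chainsIn q P.X P.A := by
  rw [← sub_eq_zero, ← map_sub, chainClass_eq_zero_iff]
  rfl

/-- A homomorphism on the representing chains that vanishes on null-homologous chains induces a
homomorphism on homology. -/
def homologyLift {K : Type} [AddCommGroup K] (φ : chainCycles q P →+ K)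
    (h : ∀ c, chainClass q P c = 0 → φ c = 0) : C1Homology q P →+ K :=
  (chainClass q P).liftOfSurjective chainClass_surjective ⟨φ, h⟩

theorem homologyLift_chainClass {K : Type} [AddCommGroup K] (φ : chainCycles q P →+ K)
    (h : ∀ c, chainClass q P c = 0 → φ c = 0) (c : chainCycles q P) :
    homologyLift φ h (chainClass q P c) = φ c :=
  AddMonoidHom.liftOfRightInverse_comp_apply _ _ _ ⟨φ, h⟩ c

/-- A chain map of pairs. -/
structure PairChainMap (P Q : DigitalPair) where
  φ : ∀ q, Chain q P.X →ₗ[ℤ] Chain q Q.X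
  mem : ∀ q c, c ∈ chainsIn q P.X P.A → φ q c ∈ chainsIn q Q.X Q.A
  comm : ∀ q c, boundary q Q.X (φ (q + 1) c) = φ q (boundary q P.X c)

theorem PairChainMap.mem_chainCycles (F : PairChainMap P Q) {c : Chain q P.X}
    (h : c ∈ chainCycles q P) : F.φ q c ∈ chainCycles q Q := by
  cases q with
  | zero => exact mem_chainCycles_zero _
  | succ q =>
    rw [mem_chainCycles_succ] at *
    rw [F.comm]
    exact F.mem _ _ h

/-- The homomorphism of homology groups induced by a chain map of pairs. -/
def PairChainMap.homologyMap (F : PairChainMap P Q) (q : ℕ) : C1Homology q P →+ C1Homology q Q :=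
  homologyLift (AddMonoidHom.mk' (fun c => chainClass q Q ⟨F.φ q c, F.mem_chainCycles c.2⟩)
    fun c d => by rw [← map_add]; congr 1; exact Subtype.ext (map_add _ _ _)) (by
      intro c hc
      rw [chainClass_eq_zero_iff] at hc
      obtain ⟨e, he⟩ := hc
      refine chainClass_eq_zero_iff.2 ⟨F.φ (q + 1) e, ?_⟩
      rw [F.comm, ← map_sub]
      exact F.mem _ _ he)

theorem PairChainMap.homologyMap_chainClass (F : PairChainMap P Q) (c : chainCycles q P) :
    F.homologyMap q (chainClass q P c) = chainClass q Q ⟨F.φ q c, F.mem_chainCycles c.2⟩ :=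
  homologyLift_chainClass _ _ _

/-- The chain map of a map of pairs. -/
def pairChainMap (f : P ⟶ Q) : PairChainMap P Q where
  φ q := chainMap q (Hom.toFun f)
  mem q _ hc := chainsIn_le_comap_chainMap q f hc
  comm q c := boundary_chainMap q (Hom.continuous f) c

/-- The homomorphism of homology groups induced by a map of pairs. -/
def inducedMap (q : ℕ) (f : P ⟶ Q) : C1Homology q P →+ C1Homology q Q :=
  (pairChainMap f).homologyMap q

theorem inducedMap_chainClass (f : P ⟶ Q) (c : chainCycles q P) :
    inducedMap q f (chainClass q P c) =
      chainClass q Q ⟨chainMap q (Hom.toFun f) c, (pairChainMap f).mem_chainCycles c.2⟩ :=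
  (pairChainMap f).homologyMap_chainClass c

theorem inducedMap_id (q : ℕ) (P : DigitalPair) :
    inducedMap q (𝟙 P) = AddMonoidHom.id (C1Homology q P) := by
  ext h
  obtain ⟨c, rfl⟩ := chainClass_surjective h
  rw [inducedMap_chainClass]
  exact congrArg (chainClass q P) (Subtype.ext (chainMap_of_coe_eq (fun _ => rfl) c.1))

theorem inducedMap_comp (q : ℕ) {P Q R : DigitalPair} (f : P ⟶ Q) (g : Q ⟶ R) :
    inducedMap q (f ≫ g) = (inducedMap q g).comp (inducedMap q f) := by
  ext h
  obtain ⟨c, rfl⟩ := chainClass_surjective h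
  rw [AddMonoidHom.comp_apply, inducedMap_chainClass, inducedMap_chainClass, inducedMap_chainClass]
  congr 1
  exact Subtype.ext (chainMap_comp q (Hom.continuous g) (Hom.continuous f) _)

/-! ### The connecting homomorphism and the exact sequence -/

/-- The inclusion of the chains in `A`. -/
def inclChain (q : ℕ) (P : DigitalPair) : Chain q P.A →ₗ[ℤ] Chain q P.X :=
  chainMap q (Set.inclusion P.sub)

theorem inclChain_restrictChain {c : Chain q P.X} (hc : c ∈ chainsIn q P.X P.A) :
    inclChain q P (restrictChain q P.X P.A c) = c :=
  chainMap_restrictChain (f := Set.inclusion P.sub) (fun _ => rfl) P.sub hc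

theorem restrictChain_inclChain (w : Chain q P.A) :
    restrictChain q P.X P.A (inclChain q P w) = w :=
  restrictChain_chainMap (f := Set.inclusion P.sub) (fun _ => rfl) P.sub w

theorem boundary_inclChain (w : Chain (q + 1) P.A) :
    boundary q P.X (inclChain (q + 1) P w) =
      inclChain q P (boundary q P.A w) :=
  boundary_chainMap q (f := Set.inclusion P.sub) (isContinuous_of_coe_eq fun _ => rfl) w

theorem inclChain_mem (w : Chain q P.A) :
    inclChain q P w ∈ chainsIn q P.X P.A :=
  chainMap_mem_chainsIn (Set.inclusion P.sub) (fun _ h => h) (mem_chainsIn_univ w)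

theorem mem_chainCycles_single_succ {n : ℕ} {X : Set (Fin n → ℤ)} {c : Chain (q + 1) X} :
    c ∈ chainCycles (q + 1) (single X) ↔ boundary q X c = 0 :=
  mem_chainCycles_succ.trans mem_chainsIn_empty

theorem chainClass_single_eq_zero_iff {n : ℕ} {X : Set (Fin n → ℤ)}
    {c : chainCycles q (single X)} :
    chainClass q (single X) c = 0 ↔ ∃ e, c.1 = boundary q X e := by
  rw [chainClass_eq_zero_iff]
  refine exists_congr fun e => mem_chainsIn_empty.trans sub_eq_zero

/-- The inclusion of chains is injective and commutes with boundaries, so `∂∂c = 0` descends to `∂w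
= 0`. -/
theorem mem_chainCycles_of_inclChain {w : Chain q P.A} {c : Chain (q + 1) P.X}
    (h : inclChain q P w = boundary q P.X c) :
    w ∈ chainCycles q (single P.A) := by
  cases q with
  | zero => exact mem_chainCycles_zero (P := single P.A) w
  | succ q =>
    rw [mem_chainCycles_single_succ, ← restrictChain_inclChain (boundary q P.A w),
      ← boundary_inclChain, h, boundary_boundary, map_zero]

/-- The boundary of a relative cycle, as a cycle in `A`. -/
theorem restrict_boundary_mem {c : Chain (q + 1) P.X} (hc : c ∈ chainCycles (q + 1) P) :
    restrictChain q P.X P.A (boundary q P.X c) ∈ chainCycles q (single P.A) :=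
  mem_chainCycles_of_inclChain
    (inclChain_restrictChain (mem_chainCycles_succ.1 hc))

/-- The connecting homomorphism. -/
def connecting (q : ℕ) (P : DigitalPair) : C1Homology (q + 1) P →+ C1Homology q (single P.A) :=
  homologyLift (AddMonoidHom.mk' (fun c => chainClass q (single P.A)
      ⟨restrictChain q P.X P.A (boundary q P.X c), restrict_boundary_mem c.2⟩)
    fun c d => by
      rw [← map_add]
      refine congrArg _ (Subtype.ext ?_)
      change restrictChain q P.X P.A (boundary q P.X (c.1 + d.1)) = _
      rw [map_add, map_add]
      rfl) (by
      intro c hc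
      rw [chainClass_eq_zero_iff] at hc
      obtain ⟨e, he⟩ := hc
      -- The chain `c - ∂e` lies in `A` and has the same boundary as `c`.
      refine chainClass_single_eq_zero_iff.2
        ⟨restrictChain (q + 1) P.X P.A ((c : Chain (q + 1) P.X) - boundary (q + 1) P.X e), ?_⟩
      rw [boundary_restrictChain P.sub he, map_sub, boundary_boundary, sub_zero])

theorem connecting_chainClass (c : chainCycles (q + 1) P) :
    connecting q P (chainClass (q + 1) P c) = chainClass q (single P.A)
      ⟨restrictChain q P.X P.A (boundary q P.X c), restrict_boundary_mem c.2⟩ :=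
  homologyLift_chainClass _ _ _

theorem connecting_chainClass_of_eq (c : chainCycles (q + 1) P) (w : Chain q P.A)
    (h : inclChain q P w = boundary q P.X c) :
    connecting q P (chainClass (q + 1) P c) =
      chainClass q (single P.A) ⟨w, mem_chainCycles_of_inclChain h⟩ := by
  rw [connecting_chainClass]
  congr 1
  refine Subtype.ext ?_
  change restrictChain q P.X P.A _ = w
  rw [← h, restrictChain_inclChain]

/-- Both sides are induced by the same map from `A` into the larger image, factored in two ways. -/
theorem inclChain_chainMap_restrict (f : P ⟶ Q) (w : Chain q P.A) :
    inclChain q Q (chainMap q (Hom.toFun (DigitalPair.restrict f)) w) =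
      chainMap q (Hom.toFun f) (inclChain q P w) :=
  (chainMap_comp q (Hom.continuous (inclSub Q)) (Hom.continuous (DigitalPair.restrict f)) w).symm.trans
    (chainMap_comp q (Hom.continuous f) (Hom.continuous (inclSub P)) w)

theorem connecting_natural (q : ℕ) (f : P ⟶ Q) :
    (connecting q Q).comp (inducedMap (q + 1) f) =
      (inducedMap q (DigitalPair.restrict f)).comp (connecting q P) := by
  ext h
  obtain ⟨c, rfl⟩ := chainClass_surjective h
  rw [AddMonoidHom.comp_apply, AddMonoidHom.comp_apply, inducedMap_chainClass,
    connecting_chainClass c, inducedMap_chainClass]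
  refine connecting_chainClass_of_eq _ _ ?_
  refine (inclChain_chainMap_restrict f _).trans ?_
  rw [inclChain_restrictChain (mem_chainCycles_succ.1 c.2)]
  exact (boundary_chainMap q (Hom.continuous f) _).symm

theorem chainClass_single_eq_iff {n : ℕ} {X : Set (Fin n → ℤ)} {c d : Chain q X}
    {hc : c ∈ chainCycles q (single X)} {hd : d ∈ chainCycles q (single X)} :
    chainClass q (single X) ⟨c, hc⟩ = chainClass q (single X) ⟨d, hd⟩ ↔
      ∃ e : Chain (q + 1) X, c - d = boundary q X e := by
  rw [chainClass_eq_iff]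
  exact exists_congr fun e => mem_chainsIn_empty.trans sub_eq_zero

theorem mem_chainCycles_of_single {c : Chain q P.X} (hc : c ∈ chainCycles q (single P.X)) :
    c ∈ chainCycles q P := by
  cases q with
  | zero => exact mem_chainCycles_zero _
  | succ q =>
    rw [mem_chainCycles_succ, mem_chainCycles_single_succ.1 hc]
    exact zero_mem _

theorem inducedMap_inclSub {w : Chain q P.A} (hw : w ∈ chainCycles q (single P.A)) :
    inducedMap q (inclSub P) (chainClass q (single P.A) ⟨w, hw⟩) =
      chainClass q (single P.X)
        ⟨inclChain q P w, (pairChainMap (inclSub P)).mem_chainCycles hw⟩ :=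
  inducedMap_chainClass _ _

theorem inducedMap_inclRel {c : Chain q P.X} (hc : c ∈ chainCycles q (single P.X)) :
    inducedMap q (inclRel P) (chainClass q (single P.X) ⟨c, hc⟩) =
      chainClass q P ⟨c, mem_chainCycles_of_single hc⟩ := by
  rw [inducedMap_chainClass]
  exact congrArg (chainClass q P) (Subtype.ext (chainMap_of_coe_eq (fun _ => rfl) c))

theorem exact_inclSub_inclRel (q : ℕ) (P : DigitalPair) :
    Function.Exact (inducedMap q (inclSub P)) (inducedMap q (inclRel P)) := by
  intro h
  obtain ⟨⟨(c : Chain q P.X), hc⟩, rfl⟩ := chainClass_surjective h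
  rw [inducedMap_inclRel, chainClass_eq_zero_iff]
  constructor
  · rintro ⟨e, he : c - boundary q P.X e ∈ _⟩
    -- The cycle `c` is homologous in `X` to `c - ∂e`, which lies in `A` and is the preimage.
    have hw : restrictChain q P.X P.A (c - boundary q P.X e) ∈ chainCycles q (single P.A) := by
      cases q with
      | zero => exact mem_chainCycles_zero (P := single P.A) _
      | succ q =>
        rw [mem_chainCycles_single_succ, boundary_restrictChain P.sub he, map_sub,
          boundary_boundary, mem_chainCycles_single_succ.1 hc, sub_zero, map_zero]
    refine ⟨chainClass q _ ⟨_, hw⟩, ?_⟩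
    rw [inducedMap_inclSub]
    refine chainClass_single_eq_iff.2 ⟨-e, ?_⟩
    rw [inclChain_restrictChain he, map_neg]
    abel
  · rintro ⟨h, hh⟩
    obtain ⟨⟨(w : Chain q P.A), hw⟩, rfl⟩ := chainClass_surjective h
    rw [inducedMap_inclSub] at hh
    obtain ⟨e, he⟩ := chainClass_single_eq_iff.1 hh
    refine ⟨-e, ?_⟩
    change c - boundary q P.X (-e) ∈ _
    have h2 : c - boundary q P.X (-e) = inclChain q P w := by
      rw [map_neg, ← he]
      abel
    rw [h2]
    exact inclChain_mem w

theorem exact_inclRel_connecting (q : ℕ) (P : DigitalPair) :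
    Function.Exact (inducedMap (q + 1) (inclRel P)) (connecting q P) := by
  intro h
  obtain ⟨⟨c, hcc⟩, rfl⟩ := chainClass_surjective h
  have hc := mem_chainCycles_succ.1 hcc
  rw [connecting_chainClass, chainClass_single_eq_zero_iff]
  constructor
  · rintro ⟨(e : Chain (q + 1) P.A), he⟩
    change restrictChain q P.X P.A (boundary q P.X c) = boundary q P.A e at he
    -- Subtracting a chain of `A` with the same boundary makes `c` an absolute cycle without
    -- changing its relative class.
    have hd : c - inclChain (q + 1) P e ∈
        chainCycles (q + 1) (single P.X) := by
      refine mem_chainCycles_single_succ.2 ?_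
      refine (map_sub (boundary q P.X) _ _).trans (sub_eq_zero.2 ?_)
      refine Eq.trans ?_ (boundary_inclChain e).symm
      rw [← he, inclChain_restrictChain hc]
    refine ⟨chainClass (q + 1) (single P.X) ⟨_, hd⟩, ?_⟩
    refine (inducedMap_inclRel hd).trans (chainClass_eq_iff.2 ⟨0, ?_⟩)
    rw [map_zero, sub_zero, sub_sub_cancel_left]
    exact neg_mem (inclChain_mem e)
  · rintro ⟨h, hh⟩
    obtain ⟨⟨(d : Chain (q + 1) P.X), hd⟩, rfl⟩ := chainClass_surjective h
    rw [inducedMap_inclRel, chainClass_eq_iff] at hh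
    obtain ⟨e, he⟩ := hh
    change d - c - boundary (q + 1) P.X e ∈ _ at he
    -- Since `∂d = 0` and `∂∂e = 0`, the boundary of `d - c - ∂e` is `-∂c`; hence the sign.
    refine ⟨-restrictChain (q + 1) P.X P.A (d - c - boundary (q + 1) P.X e), ?_⟩
    change restrictChain q P.X P.A (boundary q P.X c) = _
    rw [map_neg, boundary_restrictChain P.sub he, map_sub (boundary q P.X),
      map_sub (boundary q P.X), boundary_boundary, sub_zero,
      mem_chainCycles_single_succ.1 hd, zero_sub, map_neg, neg_neg]

theorem exact_connecting_inclSub (q : ℕ) (P : DigitalPair) :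
    Function.Exact (connecting q P) (inducedMap q (inclSub P)) := by
  intro h
  obtain ⟨⟨(w : Chain q P.A), hw⟩, rfl⟩ := chainClass_surjective h
  rw [inducedMap_inclSub, chainClass_single_eq_zero_iff]
  constructor
  · rintro ⟨e, he⟩
    have hm : e ∈ chainCycles (q + 1) P := by
      rw [mem_chainCycles_succ, ← he]
      exact inclChain_mem w
    exact ⟨chainClass _ _ ⟨e, hm⟩, connecting_chainClass_of_eq ⟨e, hm⟩ w he⟩
  · rintro ⟨h, hh⟩
    obtain ⟨⟨c, hc⟩, rfl⟩ := chainClass_surjective h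
    rw [connecting_chainClass] at hh
    obtain ⟨e, he⟩ := chainClass_single_eq_iff.1 hh
    rw [sub_eq_iff_eq_add] at he
    -- The chain `∂c` represents the class of `w` only up to `∂e` in `A`; removing `e` makes the
    -- boundary exactly `w`.
    refine ⟨c - inclChain (q + 1) P e, ?_⟩
    have h1 := congrArg (inclChain q P) he
    rw [inclChain_restrictChain (mem_chainCycles_succ.1 hc)] at h1
    rw [map_sub]
    refine Eq.trans ?_ (congrArg₂ _ h1.symm (boundary_inclChain e).symm)
    rw [map_add]
    exact (add_sub_cancel_left _ _).symm

theorem inclRel_zero_surjective (P : DigitalPair) :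
    Function.Surjective (inducedMap 0 (inclRel P)) := by
  intro h
  obtain ⟨⟨c, hc⟩, rfl⟩ := chainClass_surjective h
  exact ⟨chainClass 0 (single P.X) ⟨c, mem_chainCycles_zero (P := single P.X) c⟩,
    inducedMap_inclRel _⟩

end

/-! ### Excision -/

section

variable {q n : ℕ} {X A B : Set (Fin n → ℤ)}

theorem iterInterior_subset (i : ℕ) (A : Set (Fin n → ℤ)) : iterInterior X i A ⊆ A := by
  induction i with
  | zero => exact subset_rfl
  | succ i ih => exact fun _ hx => ih hx.1

/-- The vertices that differ in at most `i` coordinates from a vertex in the `i`-th interior of `A`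
lie in `A`. -/
theorem Cube.vertex_mem_of_mem_iterInterior (Q : Cube q X) (t' : Fin q → Bool) :
    ∀ (i : ℕ) (t : Fin q → Bool) (s : Finset (Fin q)), Q.vertex t ∈ iterInterior X i A →
      (∀ k ∉ s, t k = t' k) → s.card ≤ i → Q.vertex t' ∈ A := by
  intro i
  induction i with
  | zero =>
    intro t s ht hs hi
    have : s = ∅ := Finset.card_eq_zero.1 (Nat.le_zero.1 hi)
    subst this
    rwa [← funext fun k => hs k (Finset.notMem_empty k)]
  | succ i ih =>
    intro t s ht hs hi
    rcases s.eq_empty_or_nonempty with rfl | ⟨k, hk⟩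
    · rw [← funext fun k => hs k (Finset.notMem_empty k)]
      exact iterInterior_subset _ _ ht
    -- Correcting one coordinate moves to a neighbour or not at all, so it costs one level of
    -- interior.
    · refine ih (Function.update t k (t' k)) (s.erase k) ?_ (fun l hl => ?_) ?_
      · refine ht.2 _ (Q.vertex_mem _) ?_
        by_cases h : t k = t' k
        · rw [← h, Function.update_eq_self]
          exact Or.inl rfl
        · exact Or.inr (Q.adj_vertex_update t k _ h)
      · by_cases h : l = k
        · subst h; simp
        · rw [Function.update_of_ne h]
          exact hs l fun hl' => hl (Finset.mem_erase.2 ⟨h, hl'⟩)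
      · rw [Finset.card_erase_of_mem hk]
        omega

/-- If `t` is outside `A` and `u` outside `B`, then `t` is in the `i`-th interior of `B`, so `t` and
`u` differ in more than `i` coordinates. One step from `t` towards `u` gives a vertex within `1 ≤ i`
of `t` and within `q - 1 ≤ i` of `u`. Whichever interior contains it, this is a contradiction. -/
theorem Cube.subset_or_subset {i : ℕ} (hi : 0 < i) (hq : q ≤ i + 1)
    (hX : X = iterInterior X i A ∪ iterInterior X i B) (Q : Cube q X) :
    Q.points ⊆ A ∨ Q.points ⊆ B := by
  classical
  by_contra! h
  rw [Cube.points_subset_iff, Cube.points_subset_iff] at h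
  push Not at h
  obtain ⟨⟨t, ht⟩, ⟨u, hu⟩⟩ := h
  have hmem : ∀ t, Q.vertex t ∈ iterInterior X i A ∨ Q.vertex t ∈ iterInterior X i B := by
    intro t
    exact (Set.ext_iff.1 hX _).1 (Q.vertex_mem t)
  have htB : Q.vertex t ∈ iterInterior X i B :=
    (hmem t).resolve_left fun h => ht (iterInterior_subset _ _ h)
  let s : Finset (Fin q) := Finset.univ.filter fun k => t k ≠ u k
  have hs : i < s.card := by
    by_contra! h
    exact hu (Q.vertex_mem_of_mem_iterInterior u i t s htB (by simp [s]) h)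
  have hsq : s.card ≤ q := by simpa using Finset.card_le_univ s
  obtain ⟨k, hk⟩ := Finset.card_pos.1 (hi.trans hs)
  rcases hmem (Function.update t k (u k)) with h | h
  · refine ht (Q.vertex_mem_of_mem_iterInterior t i _ {k} h (fun l hl => ?_) (by rwa [Finset.card_singleton]))
    rw [Function.update_of_ne (by simpa using hl)]
  · refine hu (Q.vertex_mem_of_mem_iterInterior u i _ (s.erase k) h (fun l hl => ?_) ?_)
    · by_cases hlk : l = k
      · subst hlk; simp
      · rw [Function.update_of_ne hlk]
        simpa [s, hlk] using hl
    · rw [Finset.card_erase_of_mem hk]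
      omega

theorem sub_chainMap_restrictChain_mem (hB : B ⊆ X)
    (h : ∀ Q : Cube q X, Q.points ⊆ A ∨ Q.points ⊆ B) (c : Chain q X) :
    c - chainMap q (Set.inclusion hB) (restrictChain q X B c) ∈ chainsIn q X A := by
  refine chainsIn_induction
    (p := fun c => c - chainMap q (Set.inclusion hB) (restrictChain q X B c) ∈ chainsIn q X A)
    (by simp) (fun c d hc hd => ?_) (fun Q a _ => ?_) (mem_chainsIn_univ c)
  · rw [map_add, map_add, add_sub_add_comm]
    exact add_mem hc hd
  · rw [← mul_one a, ← smul_eq_mul, ← Finsupp.smul_single, map_smul, map_smul, ← smul_sub]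
    refine Submodule.smul_mem _ _ ?_
    by_cases hQ : Q.points ⊆ B
    · rw [chainMap_restrictChain (f := Set.inclusion hB) (fun _ => rfl) hB (single_mem_chainsIn Q hQ), sub_self]
      exact zero_mem _
    · rw [restrictChain_single_of_not_subset hQ, map_zero, sub_zero]
      exact single_mem_chainsIn Q ((h Q).resolve_right hQ)

theorem boundary_chainMap_inclusion (hB : B ⊆ X) (c : Chain (q + 1) B) :
    boundary q X (chainMap (q + 1) (Set.inclusion hB) c) =
      chainMap q (Set.inclusion hB) (boundary q B c) :=
  boundary_chainMap q (f := Set.inclusion hB) (isContinuous_of_coe_eq fun _ => rfl) c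

theorem inducedMap_incl {X' A' : Set (Fin n → ℤ)} (h' : A' ⊆ X') (h : A ⊆ X) (hX : X' ⊆ X)
    (hA : A' ⊆ A) {c : Chain q X'} (hc : c ∈ chainCycles q ⟨n, X', A', h'⟩) :
    inducedMap q (incl h' h hX hA) (chainClass q ⟨n, X', A', h'⟩ ⟨c, hc⟩) =
      chainClass q ⟨n, X, A, h⟩ ⟨chainMap q (Set.inclusion hX) c,
        (pairChainMap (incl h' h hX hA)).mem_chainCycles hc⟩ :=
  inducedMap_chainClass _ _

/-- Each chain is a chain in `B` plus a chain in `A`, and the latter vanishes in the relative group.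
Surjectivity splits cycles in degree `q`; injectivity splits bounding chains in degree `q + 1`. -/
theorem excision_bijective (hA : A ⊆ X) (hB : B ⊆ X)
    (h : ∀ Q : Cube q X, Q.points ⊆ A ∨ Q.points ⊆ B)
    (h' : ∀ Q : Cube (q + 1) X, Q.points ⊆ A ∨ Q.points ⊆ B) :
    Function.Bijective (inducedMap q
      (incl (Set.inter_subset_right : A ∩ B ⊆ B) hA hB Set.inter_subset_left)) := by
  constructor
  · rw [injective_iff_map_eq_zero]
    intro x hx
    obtain ⟨⟨(c : Chain q B), hc⟩, rfl⟩ := chainClass_surjective x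
    rw [inducedMap_incl, chainClass_eq_zero_iff] at hx
    obtain ⟨(e : Chain (q + 1) X), he⟩ := hx
    change chainMap q (Set.inclusion hB) c - boundary q X e ∈ chainsIn q X A at he
    rw [chainClass_eq_zero_iff]
    refine ⟨restrictChain (q + 1) X B e, ?_⟩
    refine mem_chainsIn_of_chainMap (f := Set.inclusion hB) (fun _ => rfl) hB ?_
    change chainMap q (Set.inclusion hB) (c - boundary q B (restrictChain (q + 1) X B e)) ∈ _
    rw [map_sub, ← boundary_chainMap_inclusion]
    have := add_mem he (boundary_mem_chainsIn (sub_chainMap_restrictChain_mem hB h' e))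
    rwa [map_sub, sub_add_sub_cancel] at this
  · intro x
    obtain ⟨⟨(c : Chain q X), hc⟩, rfl⟩ := chainClass_surjective x
    have hd := sub_chainMap_restrictChain_mem hB h c
    have hw : restrictChain q X B c ∈ chainCycles q ⟨n, B, A ∩ B, Set.inter_subset_right⟩ := by
      cases q with
      | zero => exact mem_chainCycles_zero _
      | succ q =>
        rw [mem_chainCycles_succ] at hc ⊢
        refine mem_chainsIn_of_chainMap (f := Set.inclusion hB) (fun _ => rfl) hB ?_
        change chainMap q (Set.inclusion hB) (boundary q B (restrictChain (q + 1) X B c)) ∈ _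
        rw [← boundary_chainMap_inclusion]
        have := sub_mem hc (boundary_mem_chainsIn hd)
        rwa [map_sub, sub_sub_cancel] at this
    refine ⟨chainClass q ⟨n, B, A ∩ B, Set.inter_subset_right⟩ ⟨_, hw⟩, ?_⟩
    rw [inducedMap_incl, chainClass_eq_iff]
    refine ⟨0, ?_⟩
    rw [map_zero, sub_zero, ← neg_sub]
    exact neg_mem hd

end

/-! ### One-point images -/

section

variable {n : ℕ} (x : Fin n → ℤ)

/-- A cube of positive dimension has two different vertices. -/
instance isEmpty_cube_singleton (q : ℕ) : IsEmpty (Cube (q + 1) ({x} : Set (Fin n → ℤ))) := by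
  refine ⟨fun Q => ?_⟩
  have h : Q.vertex (fun _ => true) = Q.vertex (fun _ => false) :=
    (Q.vertex_mem _).trans (Q.vertex_mem _).symm
  simpa using congrFun (Q.vertex_injective h) 0

theorem subsingleton_homology_singleton {q : ℕ} (hq : 0 < q) :
    Subsingleton (C1Homology q (single {x})) := by
  obtain ⟨q, rfl⟩ := Nat.exists_eq_succ_of_ne_zero hq.ne'
  have h : ∀ c d : Chain (q + 1) ({x} : Set (Fin n → ℤ)), c = d := fun c d => Subsingleton.elim c d
  refine ⟨fun a b => ?_⟩
  obtain ⟨⟨c, hc⟩, rfl⟩ := chainClass_surjective a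
  obtain ⟨⟨d, hd⟩, rfl⟩ := chainClass_surjective b
  exact congrArg (chainClass (q + 1) (single {x})) (Subtype.ext (h c d))

/-- The only `0`-cube of a one-point image. -/
def pointCube : Cube 0 ({x} : Set (Fin n → ℤ)) where
  corner := x
  dir := ⟨⟨fun i => i.elim0, fun i => i.elim0⟩, fun {i} => i.elim0⟩
  subset v hv := by
    funext j
    rcases hv j with h | ⟨⟨i, -⟩, -⟩
    · exact h
    · exact i.elim0

theorem eq_pointCube (Q : Cube 0 ({x} : Set (Fin n → ℤ))) : Q = pointCube x :=
  Cube.ext (Q.points_subset Q.corner_mem) (RelEmbedding.ext fun i => i.elim0)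

theorem eq_single_pointCube (c : Chain 0 ({x} : Set (Fin n → ℤ))) :
    c = Finsupp.single (pointCube x) (augmentation {x} c) := by
  induction c using Finsupp.induction_linear with
  | zero => simp
  | add c d hc hd => rw [map_add, Finsupp.single_add, ← hc, ← hd]
  | single Q a => simp [augmentation, eq_pointCube x Q]

theorem nonempty_homology_zero_singleton : Nonempty (C1Homology 0 (single {x}) ≃+ ℤ) := by
  let φ : C1Homology 0 (single {x}) →+ ℤ :=
    homologyLift ((augmentation {x}).toAddMonoidHom.comp
      (chainCycles 0 (single {x})).subtype.toAddMonoidHom) (by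
        intro c hc
        obtain ⟨e, he⟩ := chainClass_single_eq_zero_iff.1 hc
        change augmentation {x} c.1 = 0
        rw [he]
        exact augmentation_boundary e)
  have hφ : ∀ c, φ (chainClass 0 (single {x}) c) = augmentation {x} c.1 :=
    fun c => homologyLift_chainClass _ _ c
  refine ⟨AddEquiv.ofBijective φ ⟨?_, fun a => ?_⟩⟩
  · rw [injective_iff_map_eq_zero]
    intro h hh
    obtain ⟨⟨(c : Chain 0 {x}), hc⟩, rfl⟩ := chainClass_surjective h
    rw [hφ] at hh
    have h0 : c = 0 := by
      rw [eq_single_pointCube x c]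
      exact (congrArg _ hh).trans (Finsupp.single_zero _)
    subst h0
    exact map_zero (chainClass 0 (single {x}))
  · refine ⟨chainClass 0 (single {x}) ⟨Finsupp.single (pointCube x) a,
      mem_chainCycles_zero (P := single {x}) _⟩, (hφ _).trans ?_⟩
    exact (Finsupp.linearCombination_single ℤ a (pointCube x)).trans (mul_one a)

end

/-! ### Additivity -/

section

variable {q n : ℕ} {X A : Set (Fin n → ℤ)} {ι : Type} {U : ι → Set (Fin n → ℤ)}

/-- An elementary cube in a union of separated subsets lies in one of them. -/
theorem Cube.exists_subset (hX : X = ⋃ α, U α)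
    (hU : ∀ α β, α ≠ β → ∀ x ∈ U α, ∀ y ∈ U β, ¬ AdjEq x y) (Q : Cube q X) :
    ∃ α, Q.points ⊆ U α := by
  have hmem : ∀ t, ∃ α, Q.vertex t ∈ U α := fun t => by
    exact Set.mem_iUnion.1 ((Set.ext_iff.1 hX _).1 (Q.vertex_mem t))
  obtain ⟨α, hα⟩ := hmem fun _ => false
  refine ⟨α, Q.points_subset_iff.2 fun t => ?_⟩
  induction t using boolVec_induction with
  | h0 => exact hα
  | hs t k hk ih =>
    obtain ⟨β, hβ⟩ := hmem (Function.update t k true)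
    by_cases h : α = β
    · exact h ▸ hβ
    · exact absurd (Or.inr (Q.adj_vertex_update t k true (by simp [hk])))
        (hU α β h _ ih _ hβ)

theorem disjoint_of_separated (hU : ∀ α β, α ≠ β → ∀ x ∈ U α, ∀ y ∈ U β, ¬ AdjEq x y) {α β : ι}
    (h : α ≠ β) : U α ⊆ (U β)ᶜ :=
  fun x hx hx' => hU α β h x hx x hx' (Or.inl rfl)

/-- The restriction of chains to a part of `X` that is separated from the rest. -/
def restrictPairChainMap (hA : A ⊆ X) {V : Set (Fin n → ℤ)} (hV : V ⊆ X)
    (h : ∀ (q : ℕ) (Q : Cube q X), Q.points ⊆ V ∨ Q.points ⊆ Vᶜ) :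
    PairChainMap ⟨n, X, A, hA⟩ ⟨n, V, A ∩ V, Set.inter_subset_right⟩ where
  φ q := restrictChain q X V
  mem q _ hc := restrictChain_mem_chainsIn hc
  comm q c := by
    refine chainsIn_induction (p := fun c => boundary q V (restrictChain (q + 1) X V c) =
      restrictChain q X V (boundary q X c)) (by simp) (fun c d hc hd => by simp only [map_add, hc, hd])
      (fun Q a _ => ?_) (mem_chainsIn_univ c)
    rw [← mul_one a, ← smul_eq_mul, ← Finsupp.smul_single]
    simp only [map_smul]
    congr 1
    -- Restriction is a chain map here because a cube not inside `V` avoids it, and then so do its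
    -- faces.
    rcases h _ Q with hQ | hQ
    · exact boundary_restrictChain hV (single_mem_chainsIn Q hQ)
    · have hm := single_mem_chainsIn Q hQ
      rw [restrictChain_eq_zero hm, restrictChain_eq_zero (boundary_mem_chainsIn hm), map_zero]

open scoped Classical in
-- A chain meets only finitely many of the `U α`. Allowing every larger `s'` lets the index sets of
-- two summands be merged.
theorem exists_sum_restrictChain (hU' : ∀ α, U α ⊆ X) (hX : X = ⋃ α, U α)
    (hU : ∀ α β, α ≠ β → ∀ x ∈ U α, ∀ y ∈ U β, ¬ AdjEq x y) (c : Chain q X) :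
    ∃ s : Finset ι, ∀ s', s ⊆ s' →
      ∑ α ∈ s', chainMap q (Set.inclusion (hU' α)) (restrictChain q X (U α) c) = c := by
  induction c using Finsupp.induction_linear with
  | zero => exact ⟨∅, by simp⟩
  | add c d hc hd =>
    obtain ⟨s, hs⟩ := hc
    obtain ⟨t, ht⟩ := hd
    refine ⟨s ∪ t, fun s' h => ?_⟩
    simp only [map_add, Finset.sum_add_distrib]
    rw [hs s' (Finset.union_subset_left h), ht s' (Finset.union_subset_right h)]
  | single Q a =>
    obtain ⟨α, hα⟩ := Q.exists_subset hX hU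
    have hm : ∀ {V}, Q.points ⊆ V → Finsupp.single Q a ∈ chainsIn q X V := fun h => by
      rw [← mul_one a, ← smul_eq_mul, ← Finsupp.smul_single]
      exact Submodule.smul_mem _ _ (single_mem_chainsIn Q h)
    refine ⟨{α}, fun s' h => ?_⟩
    rw [Finset.sum_eq_single α]
    · exact chainMap_restrictChain (f := Set.inclusion (hU' α)) (fun _ => rfl) (hU' α) (hm hα)
    · intro β _ hβ
      rw [restrictChain_eq_zero (hm (hα.trans (disjoint_of_separated hU hβ.symm))), map_zero]
    · exact fun hα' => absurd (Finset.singleton_subset_iff.1 h) hα'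

open scoped Classical in
-- Restriction to `U β` recovers the `β`-component of an element of the direct sum, which gives
-- injectivity. Surjectivity holds since a cycle is the finite sum of its restrictions, each a
-- relative cycle.
theorem additivity_bijective (q : ℕ) (hA : A ⊆ X) (hU' : ∀ α, U α ⊆ X) (hX : X = ⋃ α, U α)
    (hU : ∀ α β, α ≠ β → ∀ x ∈ U α, ∀ y ∈ U β, ¬ AdjEq x y) :
    Function.Bijective (DirectSum.toAddMonoid fun α => inducedMap q
      (incl (Set.inter_subset_right : A ∩ U α ⊆ U α) hA (hU' α) Set.inter_subset_left)) := by
  have hV : ∀ α (q : ℕ) (Q : Cube q X), Q.points ⊆ U α ∨ Q.points ⊆ (U α)ᶜ := by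
    intro α q Q
    obtain ⟨β, hβ⟩ := Q.exists_subset hX hU
    by_cases h : α = β
    · exact Or.inl (h ▸ hβ)
    · exact Or.inr (hβ.trans (disjoint_of_separated hU (Ne.symm h)))
  let π := fun α => (restrictPairChainMap hA (hU' α) (hV α)).homologyMap q
  constructor
  · rw [injective_iff_map_eq_zero]
    intro x hx
    have key : ∀ x β, π β (DirectSum.toAddMonoid (fun α => inducedMap q
        (incl (Set.inter_subset_right : A ∩ U α ⊆ U α) hA (hU' α) Set.inter_subset_left)) x) =
          x β := by
      intro x β
      induction x using DirectSum.induction_on with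
      | zero => simp
      | add x y hx hy => rw [map_add, map_add, hx, hy]; rfl
      | of α h =>
        obtain ⟨⟨(c : Chain q (U α)), hc⟩, rfl⟩ := chainClass_surjective h
        rw [DirectSum.toAddMonoid_of, inducedMap_incl]
        refine (PairChainMap.homologyMap_chainClass _ _).trans ?_
        by_cases hαβ : α = β
        · subst hαβ
          rw [DirectSum.of_eq_same]
          exact congrArg (chainClass q _) (Subtype.ext
            (restrictChain_chainMap (f := Set.inclusion (hU' α)) (fun _ => rfl) (hU' α) c))
        · rw [DirectSum.of_eq_of_ne _ _ _ (Ne.symm hαβ), ← map_zero (chainClass q _)]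
          refine congrArg (chainClass q _) (Subtype.ext ?_)
          refine restrictChain_eq_zero (chainMap_mem_chainsIn (Set.inclusion (hU' α))
            (A := U α) (fun y hy => ?_) (mem_chainsIn_univ c))
          exact disjoint_of_separated hU hαβ hy
    ext β
    rw [← key x β, hx, map_zero]
    rfl
  · intro x
    obtain ⟨⟨(c : Chain q X), hc⟩, rfl⟩ := chainClass_surjective x
    obtain ⟨s, hs⟩ := exists_sum_restrictChain hU' hX hU c
    have hw : ∀ α, restrictChain q X (U α) c ∈
        chainCycles q ⟨n, U α, A ∩ U α, Set.inter_subset_right⟩ :=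
      fun α => (restrictPairChainMap hA (hU' α) (hV α)).mem_chainCycles hc
    have hm : ∀ α, chainMap q (Set.inclusion (hU' α)) (restrictChain q X (U α) c) ∈
        chainCycles q ⟨n, X, A, hA⟩ := fun α => (pairChainMap (incl Set.inter_subset_right hA
      (hU' α) Set.inter_subset_left)).mem_chainCycles (hw α)
    have key : ∀ α, ∃ y, DirectSum.toAddMonoid (fun α => inducedMap q
        (incl (Set.inter_subset_right : A ∩ U α ⊆ U α) hA (hU' α) Set.inter_subset_left)) y =
          chainClass q ⟨n, X, A, hA⟩ ⟨_, hm α⟩ := fun α =>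
      ⟨DirectSum.of _ α (chainClass q _ ⟨_, hw α⟩), by
        rw [DirectSum.toAddMonoid_of, inducedMap_incl]⟩
    choose y hy using key
    refine ⟨∑ α ∈ s, y α, ?_⟩
    rw [map_sum, Finset.sum_congr rfl fun α _ => hy α, ← map_sum]
    refine congrArg (chainClass q _) (Subtype.ext ?_)
    rw [AddSubmonoidClass.coe_finsetSum]
    exact hs s subset_rfl

end

/-! ### Homotopy -/

section

variable {q n m : ℕ} {X : Set (Fin n → ℤ)} {Y : Set (Fin m → ℤ)}

/-- The cylinder `{0, 1} × X`. -/
def cylinder (X : Set (Fin n → ℤ)) : Set (Fin (n + 1) → ℤ) :=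
  {v | (v 0 = 0 ∨ v 0 = 1) ∧ Fin.tail v ∈ X}

/-- The ends of the cylinder. -/
def cylinderEnd (X : Set (Fin n → ℤ)) (b : Bool) (x : X) : cylinder X :=
  ⟨Fin.cons b.toInt x.1, by cases b <;> simp, by rw [Fin.tail_cons]; exact x.2⟩

open scoped Classical in
/-- The function on the cylinder that is `f` at `0` and `g` at `1`. -/
def cylinderMap (f g : X → Y) (v : cylinder X) : Y :=
  if v.1 0 = 0 then f ⟨Fin.tail v.1, v.2.2⟩ else g ⟨Fin.tail v.1, v.2.2⟩

theorem isContinuous_cylinderEnd (X : Set (Fin n → ℤ)) (b : Bool) :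
    IsContinuous (cylinderEnd X b) := by
  rintro x x' ⟨i, hi, h⟩
  refine Or.inr ⟨i.succ, by simpa [cylinderEnd] using hi, fun j hj => ?_⟩
  refine Fin.cases ?_ (fun j hj => ?_) j hj
  · intro; simp [cylinderEnd]
  · simpa [cylinderEnd] using h j fun e => hj (congrArg _ e)

/-- An edge of the cylinder is either vertical, where `hfg` applies, or inside one end, where `f` or
`g` is continuous. No diagonal adjacency occurs. -/
theorem isContinuous_cylinderMap {f g : X → Y} (hf : IsContinuous f) (hg : IsContinuous g)
    (hfg : ∀ x, AdjEq (f x : Fin m → ℤ) (g x)) : IsContinuous (cylinderMap f g) := by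
  rintro ⟨v, hv⟩ ⟨v', hv'⟩ ⟨i, hi, h⟩
  change |v i - v' i| = 1 at hi
  change ∀ j, j ≠ i → v j = v' j at h
  rcases Fin.eq_zero_or_eq_succ i with rfl | ⟨i, rfl⟩
  · have ht : Fin.tail v = Fin.tail v' := funext fun j => h j.succ (Fin.succ_ne_zero j)
    rcases hv.1 with h0 | h0 <;> rcases hv'.1 with h1 | h1
    · simp [h0, h1] at hi
    · simpa [cylinderMap, h0, h1, ht] using hfg ⟨Fin.tail v', hv'.2⟩
    · simpa [cylinderMap, h0, h1, ht] using (hfg ⟨Fin.tail v', hv'.2⟩).symm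
    · simp [h0, h1] at hi
  · have h0 : v 0 = v' 0 := h 0 (Fin.succ_ne_zero i).symm
    have ht : Adj (Fin.tail v) (Fin.tail v') :=
      ⟨i, hi, fun j hj => h j.succ fun e => hj (Fin.succ_injective _ e)⟩
    by_cases hz : v' 0 = 0
    · simpa [cylinderMap, h0, hz] using hf ⟨_, hv.2⟩ ⟨_, hv'.2⟩ ht
    · simpa [cylinderMap, h0, hz] using hg ⟨_, hv.2⟩ ⟨_, hv'.2⟩ ht

/-! ### Prisms and the chain homotopy -/

/-- The prism `{0, 1} × Q` over an elementary cube `Q`. -/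
def Cube.prism (Q : Cube q X) : Cube (q + 1) (cylinder X) where
  corner := Fin.cons 0 Q.corner
  dir := OrderEmbedding.ofStrictMono (Fin.cons 0 fun k => (Q.dir k).succ) (by
    intro k l
    refine Fin.cases ?_ (fun l => ?_) l
    · intro h; exact absurd h (Fin.not_lt_zero k)
    · refine Fin.cases ?_ (fun k h => ?_) k
      · intro; simp
      · simpa using h)
  subset v hv := by
    refine ⟨?_, Q.subset fun j => ?_⟩
    · rcases hv 0 with h | ⟨-, h⟩
      · exact Or.inl h
      · exact Or.inr h
    · rcases hv j.succ with h | ⟨⟨k, hk⟩, h⟩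
      · exact Or.inl h
      · refine Or.inr ⟨?_, h⟩
        revert hk
        refine Fin.cases ?_ (fun k hk => ?_) k
        · intro hk; exact absurd hk (Fin.succ_ne_zero j).symm
        · exact ⟨k, Fin.succ_injective _ hk⟩

theorem Cube.prism_dir_zero (Q : Cube q X) : Q.prism.dir 0 = 0 := rfl

theorem Cube.prism_dir_succ (Q : Cube q X) (k : Fin q) :
    Q.prism.dir k.succ = (Q.dir k).succ := rfl

/-- The new direction is placed first, so the old directions are shifted by one; this shift is the
source of the minus sign in `boundary_prismMap`. -/
theorem Cube.prism_face_succ (Q : Cube (q + 1) X) (i : Fin (q + 1)) (b : Bool) :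
    Q.prism.face i.succ b = (Q.face i b).prism := by
  refine Cube.ext ?_ (RelEmbedding.ext fun k => ?_)
  · rw [face_corner, prism_dir_succ]
    funext j
    refine Fin.cases ?_ (fun j => ?_) j
    · simp [prism]
    · simp [prism, face_corner, Pi.single_apply]
  · rw [face_dir]
    refine Fin.cases ?_ (fun k => ?_) k
    · rfl
    · rw [Fin.succ_succAbove_succ, prism_dir_succ, prism_dir_succ, face_dir]

/-- Regarding `Q` as a cube in the image `Q.points` makes this the containment of its prism in the
cylinder. -/
theorem Cube.tail_mem_points_of_mem_prism (Q : Cube q X) {v : Fin (n + 1) → ℤ}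
    (hv : v ∈ Q.prism.points) : Fin.tail v ∈ Q.points :=
  ((Q.copy subset_rfl : Cube q Q.points).prism.points_subset hv).2

theorem cubeMap_cylinderEnd (b : Bool) (Q : Cube q X) :
    cubeMap (cylinderEnd X b) Q = Finsupp.single (Q.prism.face 0 b) 1 := by
  have h : IsSignedPerm (cylinderEnd X b) Q (Q.prism.face 0 b) 1 (fun _ => false) := by
    intro t
    rw [twist_one]
    funext j
    change (Fin.cons b.toInt (Q.vertex t) : Fin (n + 1) → ℤ) j = _
    have hc : (Q.prism.face 0 b).corner = Fin.cons b.toInt Q.corner := by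
      rw [Cube.face_corner, Cube.prism_dir_zero]
      funext j
      refine Fin.cases ?_ (fun j => ?_) j <;> simp [Cube.prism]
    have hd : ∀ k, (Q.prism.face 0 b).dir k = (Q.dir k).succ := fun k => by
      rw [Cube.face_dir, Fin.zero_succAbove, Cube.prism_dir_succ]
    refine Fin.cases ?_ (fun j => ?_) j
    · rw [Cube.vertex_of_notMem, hc]
      · simp
      · rintro ⟨k, hk⟩
        rw [hd] at hk
        exact Fin.succ_ne_zero _ hk
    · rw [Fin.cons_succ]
      by_cases hj : j ∈ Set.range Q.dir
      · obtain ⟨k, rfl⟩ := hj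
        rw [← hd, Cube.vertex_dir, Cube.vertex_dir, hc, hd, Fin.cons_succ]
      · rw [Cube.vertex_of_notMem _ _ hj, Cube.vertex_of_notMem, hc, Fin.cons_succ]
        rintro ⟨k, hk⟩
        rw [hd] at hk
        exact hj ⟨k, Fin.succ_injective _ hk⟩
  rw [h.cubeMap_eq, signedPermMatrix_one, Matrix.det_one]

/-- The prism operator. -/
def prismMap (q : ℕ) (X : Set (Fin n → ℤ)) : Chain q X →ₗ[ℤ] Chain (q + 1) (cylinder X) :=
  Finsupp.linearCombination ℤ fun Q => Finsupp.single Q.prism 1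

theorem boundary_prismMap_zero (c : Chain 0 X) :
    boundary 0 (cylinder X) (prismMap 0 X c) =
      chainMap 0 (cylinderEnd X true) c - chainMap 0 (cylinderEnd X false) c := by
  induction c using Finsupp.induction_linear with
  | zero => simp
  | add c d hc hd => simp only [map_add, hc, hd]; abel
  | single Q a =>
    rw [chainMap_single, chainMap_single, cubeMap_cylinderEnd, cubeMap_cylinderEnd, prismMap,
      Finsupp.linearCombination_single, map_smul, boundary_single, ← smul_sub]
    simp

/-- The faces in direction `0` are the two ends of the prism; the others are prisms over the faces
of `Q`, with reversed signs. -/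
theorem boundary_prismMap (c : Chain (q + 1) X) :
    boundary (q + 1) (cylinder X) (prismMap (q + 1) X c) =
      chainMap (q + 1) (cylinderEnd X true) c - chainMap (q + 1) (cylinderEnd X false) c -
        prismMap q X (boundary q X c) := by
  induction c using Finsupp.induction_linear with
  | zero => simp
  | add c d hc hd => simp only [map_add, hc, hd]; abel
  | single Q a =>
    rw [← mul_one a, ← smul_eq_mul, ← Finsupp.smul_single]
    simp only [map_smul, ← smul_sub]
    congr 1
    rw [chainMap_single, chainMap_single, cubeMap_cylinderEnd, cubeMap_cylinderEnd, prismMap,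
      Finsupp.linearCombination_single, one_smul, one_smul, one_smul, boundary_single,
      boundary_single, Fin.sum_univ_succ, sub_eq_add_neg _ (prismMap q X _), map_sum,
      ← Finset.sum_neg_distrib]
    congr 1
    · simp
    · refine Finset.sum_congr rfl fun i _ => ?_
      rw [Cube.prism_face_succ, Cube.prism_face_succ, map_smul, map_sub, prismMap,
        Finsupp.linearCombination_single, Finsupp.linearCombination_single, one_smul, one_smul,
        ← neg_smul, Fin.val_succ, pow_succ _ ((i : ℕ) + 1), mul_neg_one]

theorem prismMap_mem_chainsIn {A : Set (Fin n → ℤ)} {c : Chain q X} (hc : c ∈ chainsIn q X A) :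
    prismMap q X c ∈ chainsIn (q + 1) (cylinder X) {v | Fin.tail v ∈ A} := by
  refine chainsIn_induction
    (p := fun c => prismMap q X c ∈ chainsIn (q + 1) (cylinder X) {v | Fin.tail v ∈ A}) (by simp)
    (fun c d hc hd => by rw [map_add]; exact add_mem hc hd) (fun Q a h => ?_) hc
  rw [prismMap, Finsupp.linearCombination_single]
  exact Submodule.smul_mem _ _ (single_mem_chainsIn _ fun v hv =>
    h (Q.tail_mem_points_of_mem_prism hv))

theorem chainMap_cylinderMap {f g : X → Y} (hf : IsContinuous f) (hg : IsContinuous g)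
    (hfg : ∀ x, AdjEq (f x : Fin m → ℤ) (g x)) (c : Chain q X) :
    chainMap q (cylinderMap f g) (chainMap q (cylinderEnd X false) c) = chainMap q f c ∧
      chainMap q (cylinderMap f g) (chainMap q (cylinderEnd X true) c) = chainMap q g c := by
  have hF := isContinuous_cylinderMap hf hg hfg
  rw [← chainMap_comp q hF (isContinuous_cylinderEnd X _),
    ← chainMap_comp q hF (isContinuous_cylinderEnd X _)]
  have h1 : cylinderMap f g ∘ cylinderEnd X false = f := by
    funext x; simp [cylinderMap, cylinderEnd]
  have h2 : cylinderMap f g ∘ cylinderEnd X true = g := by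
    funext x; simp [cylinderMap, cylinderEnd]
  rw [h1, h2]
  exact ⟨rfl, rfl⟩

end

/-- The prism chain of `c`, pushed forward along `cylinderMap`, bounds the difference of the two
images up to the prism over `∂c`, which is sent to chains of the subspace. -/
theorem inducedMap_eq_of_adjEq (q : ℕ) {P Q : DigitalPair} (f g : P ⟶ Q)
    (h : ∀ x : P.X, AdjEq (Hom.toFun f x : Fin Q.n → ℤ) (Hom.toFun g x)) :
    inducedMap q f = inducedMap q g := by
  have hf := Hom.continuous f
  have hg := Hom.continuous g
  have hF := isContinuous_cylinderMap hf hg h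
  ext x
  obtain ⟨⟨c, hc⟩, rfl⟩ := chainClass_surjective x
  rw [inducedMap_chainClass, inducedMap_chainClass, eq_comm, chainClass_eq_iff]
  refine ⟨chainMap (q + 1) (cylinderMap (Hom.toFun f) (Hom.toFun g)) (prismMap q P.X c), ?_⟩
  change chainMap q (Hom.toFun g) c - chainMap q (Hom.toFun f) c - _ ∈ _
  obtain ⟨h1, h2⟩ := chainMap_cylinderMap hf hg h c
  rw [boundary_chainMap q hF]
  cases q with
  | zero =>
    rw [boundary_prismMap_zero, map_sub, h1, h2, sub_self]
    exact zero_mem _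
  | succ q =>
    rw [boundary_prismMap, map_sub, map_sub, h1, h2, sub_sub_cancel]
    refine chainMap_mem_chainsIn _ (fun v hv => ?_)
      (prismMap_mem_chainsIn (mem_chainCycles_succ.1 hc))
    rw [cylinderMap]
    split_ifs
    · exact Hom.mapsTo f _ hv
    · exact Hom.mapsTo g _ hv

theorem inducedMap_eq_of_homotopic (q : ℕ) {P Q : DigitalPair} (f g : P ⟶ Q)
    (h : Homotopic f g) : inducedMap q f = inducedMap q g := by
  obtain ⟨k, H, -, rfl, rfl, hH⟩ := h
  have key : ∀ t : Fin (k + 1), inducedMap q (H 0) = inducedMap q (H t) := by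
    intro t
    induction t using Fin.induction with
    | zero => rfl
    | succ t ih =>
      exact ih.trans (inducedMap_eq_of_adjEq q _ _ fun x => hH x t.castSucc t.succ (by simp))
  exact key _

/-- The `c₁`-cubical homology theory. -/
def cubicalHomologyTheory : DigitalHomologyTheory C1Homology where
  map q _ _ f := inducedMap q f
  map_id := inducedMap_id
  map_comp q _ _ _ f g := inducedMap_comp q f g
  δ := connecting
  δ_natural q _ _ f := connecting_natural q f
  homotopy q _ _ f g h := inducedMap_eq_of_homotopic q f g h
  exact_X := exact_inclSub_inclRel
  exact_rel := exact_inclRel_connecting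
  exact_A := exact_connecting_inclSub
  exact_zero := inclRel_zero_surjective
  -- The bound `q < i + 1` is exactly `q + 1 ≤ i + 1`, which the splitting of `(q + 1)`-cubes
  -- requires.
  excision _ _ _ hA hB _ _ hi hX hq := excision_bijective hA hB
    (Cube.subset_or_subset hi hq.le hX) (Cube.subset_or_subset hi hq hX)
  dimension x _ hq := subsingleton_homology_singleton x hq
  additivity _ _ hA _ _ hU hX hsep q := additivity_bijective q hA hU hX hsep

end DigitalHomology

end

/-- The `c₁`-cubical homology groups, with the homomorphisms induced by the chain maps of continuous
functions and with the connecting homomorphisms of pairs, form a digital homology theory, whose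
coefficient group is `ℤ`. -/
theorem mainTheorem11 :
    ∃ T : DigitalHomology.DigitalHomologyTheory DigitalHomology.C1Homology,
      -- the induced homomorphism sends the class of `z` to the class of its image
      (∀ (q : ℕ) (P Q : DigitalHomology.DigitalPair) (f : P ⟶ Q)
        (z : DigitalHomology.RelChain q P) (hz : z ∈ DigitalHomology.relCycles q P),
        ∃ hz' : DigitalHomology.relChainMap q f z ∈ DigitalHomology.relCycles q Q,
          T.map q f (DigitalHomology.homologyClass z hz) =
            DigitalHomology.homologyClass (DigitalHomology.relChainMap q f z) hz') ∧
      -- the connecting homomorphism sends the class of `c` to the class of its boundary in `A`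
      (∀ (q : ℕ) (P : DigitalHomology.DigitalPair) (c : DigitalHomology.Chain (q + 1) P.X)
        (hc : (Submodule.Quotient.mk c : DigitalHomology.RelChain (q + 1) P) ∈
          DigitalHomology.relCycles (q + 1) P)
        (w : DigitalHomology.Chain q (DigitalHomology.DigitalPair.single P.A).X),
        DigitalHomology.chainMap q
            (DigitalHomology.DigitalPair.Hom.toFun (DigitalHomology.DigitalPair.inclSub P)) w =
          DigitalHomology.boundary q P.X c →
        ∃ hw : (Submodule.Quotient.mk w :
              DigitalHomology.RelChain q (DigitalHomology.DigitalPair.single P.A)) ∈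
            DigitalHomology.relCycles q (DigitalHomology.DigitalPair.single P.A),
          T.δ q P (DigitalHomology.homologyClass (Submodule.Quotient.mk c) hc) =
            DigitalHomology.homologyClass (Submodule.Quotient.mk w) hw) ∧
      (∀ (n : ℕ) (x : Fin n → ℤ), Nonempty
        (DigitalHomology.C1Homology 0 (DigitalHomology.DigitalPair.single {x}) ≃+ ℤ)) := by
  open DigitalHomology in
  refine ⟨cubicalHomologyTheory, fun q P Q f z hz => ?_, fun q P c hc w h => ?_,
    fun n x => nonempty_homology_zero_singleton x⟩
  · obtain ⟨c, rfl⟩ := Submodule.Quotient.mk_surjective _ z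
    exact ⟨(pairChainMap f).mem_chainCycles hz, inducedMap_chainClass f ⟨c, hz⟩⟩
  · exact ⟨mem_chainCycles_of_inclChain h, connecting_chainClass_of_eq ⟨c, hc⟩ w h⟩
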